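/- **Setting.** Let $\mathcal G$ and $\mathcal S$ be finite sets (generators, storage units), $T$ the number of periods, $d\in\mathbb R^T$ a demand, $\alpha_j>0$ $(j\in\mathcal G)$ and $\beta_i>0$ $(i\in\mathcal S)$ bids, $\underline g_j,\overline g_j,\underline u_i,\overline u_i$ real limits, $E_i>0$ capacities and $x_{o,i}\in\mathbb R$ initial states of charge. For $u_i\in\mathbb R^T$ let $x_i\in\mathbb R^{T+1}$ be the profile $x_{i,0}=x_{o,i}$, $x_{i,t}=x_{i,t-1}-u_{i,t}/E_i$. *Rainflow algorithm on $x=(x_0,\dots,x_T)$.* Keep the times $0$, $T$ and those at which $x$ switches between charging and discharging. As long as there are four consecutive kept times $s_1,s_2,s_3,s_4$ with $|x_{s_2}-x_{s_3}|\le\min(|x_{s_1}-x_{s_2}|,|x_{s_3}-x_{s_4}|)$, record the pair $\{s_2,s_3\}$ twice (a full cycle is two half-cycles) and delete $s_2,s_3$. Finally record once each pair of consecutive remaining times. Direct each recorded pair from the larger value of $x$ to the smaller one, and list the at most $T$ edges by nondecreasing depth (difference of the values of $x$), preceded by zeros up to length $T$. $M(x)\in\mathbb R^{(T+1)\times T}$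 is the incidence matrix: the column of an edge $(s,t)$ is $e_s-e_t$, and the column of a filling zero is $0$. With the $T\times(T+1)$ difference matrix $A$, $(Ax)_t=x_t-x_{t-1}$, and its Moore–Penrose inverse $A^\dagger$, put $N(u_i)=-\frac1{E_i}M(x_i)^TA^\dagger$. The matrices $N_k(u_i)$ associated with $u_i$ are those $B$ for which there is an open set with $u_i$ in its closure on which $N(\cdot)=B$. *CYCLE AWARE SYSTEM.* Minimize $$\sum_{i\in\mathcal S}\frac1{2\beta_i}\nu_i^T\nu_i+\sum_{j\in\mathcal G}\frac1{2\alpha_j}g_j^Tg_j$$ over $g_j,u_i,\nu_i\in\mathbb R^T$, subject to $\nu_i=N(u_i)u_i$, $\;\underline g_j\le g_{j,t}\le\overline g_j$, $\;\underline u_i\le u_{i,t}\le\overline u_i$, $\;\mathbf 1^Tu_i=0$, $\;(x_{o,i}-1)\mathbf 1\le\tilde A_iu_i\le x_{o,i}\mathbf 1$ and $d=\sum_jg_j+\sum_iu_i$, where $\tilde A_i$ is $\frac1{E_i}$ times the lower triangular $T\times T$ matrix of ones. *Dual variables.* Let $\lambda\in\mathbb R^T$ (market-clearing prices), $\theta_i\in\mathbb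 R^T$ (per-cycle prices) and $\delta_i\in\mathbb R$ belong to the power balance, the Rainflow constraint and the periodicity constraint, and let $\underline\eta_j,\overline\eta_j,\underline\mu_i,\overline\mu_i,\underline\kappa_i,\overline\kappa_i\in\mathbb R^T_{\ge0}$ belong to the limits on $g_j$, $\tilde A_iu_i$ and $u_i$. A feasible point $(g,u,\nu)$ with such dual variables is *locally optimal* if $(g,u,\nu)$ is a local minimizer, complementary slackness holds, and $$\lambda=\tfrac{g_j}{\alpha_j}+\overline\eta_j-\underline\eta_j,\qquad \theta_i=\tfrac{\nu_i}{\beta_i},\qquad \lambda=\sum_k\gamma_{i,k}N_k(u_i)^T\theta_i+\delta_i\mathbf 1+\tilde A_i^T(\overline\mu_i-\underline\mu_i)+\overline\kappa_i-\underline\kappa_i$$ for some $\gamma_{i,k}\ge0$ with $\sum_k\gamma_{i,k}=1$. It is *globally optimal* if $(g,u,\nu)$ is a global minimizer, complementary slackness holds, and $(g,u,\nu)$ minimizes the Lagrangian with these dual variables over all $(g,u,\nu)$ (so the dual variables solve the dual problem, without duality gap). **Proposition.** The CYCLE AWARE SYSTEM problem is in general nonconvex: there are data (already with one generator, one storage unit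 and $T=2$) for which its feasible set is not convex. Even so, for all data: 1. every local minimizer $(g,u,\nu)$ is a global minimizer; 2. every locally optimal solution $(g,u,\nu)$ with prices $(\lambda,\theta)$ and the other dual variables is a globally optimal solution, with the same prices and dual variables. -/

import Mathlib

namespace CycleAware

noncomputable section

open scoped Matrix Topology

/-! ### Rainflow cycle counting

A state-of-charge (SoC) profile is a function `x` on a set `ι` of nodes (the times); a list of nodes
is read in temporal order, and a pair of nodes stands for the half-cycle between them. -/

section Rainflow

variable {ι : Type*}

/-- Put the earlier node `a` in front of a list of switching times of the later part of the profile.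
The former first node `b` is dropped if the profile does not turn at `b`, that is, if `x b` lies
between `x a` and the value at the next switching time `c`. -/
def addSwitch (x : ι → ℝ) (a : ι) : List ι → List ι
  | b :: c :: l =>
      if min (x a) (x c) ≤ x b ∧ x b ≤ max (x a) (x c) then a :: c :: l else a :: b :: c :: l
  | l => a :: l

/-- Switching time identification: the first node, the last node, and the nodes in between at which
the profile switches between charging and discharging. -/
def switchingTimes (x : ι → ℝ) (l : List ι) : List ι :=
  l.foldr (addSwitch x) []

/-- Search for the first four consecutive nodes `a, b, c, d` for which the middle difference
`|x b - x c|` is the smallest of the three consecutive differences. If there are such nodes, return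
`(b, c)` and the list with `b` and `c` removed. -/
def findFullCycle (x : ι → ℝ) : List ι → Option ((ι × ι) × List ι)
  | a :: b :: c :: d :: l =>
      if |x b - x c| ≤ |x a - x b| ∧ |x b - x c| ≤ |x c - x d| then
        some ((b, c), a :: d :: l)
      else
        (findFullCycle x (b :: c :: d :: l)).map fun p => (p.1, a :: p.2)
  | _ => none

/-- Extract full cycles as long as possible, each one as two half-cycles (one charging and one
discharging) between the same two nodes; then add the remaining half-cycles, between consecutive
remaining nodes. The number `n` bounds the number of extractions; the length of the list is always
enough, because an extraction removes two nodes. -/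
def extractCycles (x : ι → ℝ) : ℕ → List ι → List (ι × ι)
  | 0, l => l.zip l.tail
  | n + 1, l =>
      match findFullCycle x l with
      | none => l.zip l.tail
      | some (e, l') => e :: e :: extractCycles x n l'

/-- All the half-cycles that the Rainflow algorithm counts on the profile `x` along `l`. -/
def halfCycles (x : ι → ℝ) (l : List ι) : List (ι × ι) :=
  extractCycles x (switchingTimes x l).length (switchingTimes x l)

/-- Direct a half-cycle from the node with the larger SoC to the node with the smaller SoC. -/
def orient (x : ι → ℝ) (e : ι × ι) : ι × ι :=
  if x e.2 ≤ x e.1 then e else (e.2, e.1)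

/-- The depth of a half-cycle. -/
def depth (x : ι → ℝ) (e : ι × ι) : ℝ := |x e.1 - x e.2|

end Rainflow

/-- The directed edges of the Rainflow graph of `x`, in the order of nondecreasing depth. The list is
filled up to length `T` with loops `(0, 0)`, which have depth zero and give zero columns in the
incidence matrix. -/
def edges {T : ℕ} (x : Fin (T + 1) → ℝ) : List (Fin (T + 1) × Fin (T + 1)) :=
  let l := (halfCycles x (List.finRange (T + 1))).map (orient x)
  (List.replicate (T - l.length) (0, 0) ++ l).insertionSort fun e f => depth x e ≤ depth x f

/-- The incidence matrix `M(x)` of the Rainflow graph: column `k` has `1` at the source and `-1` at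
the target of edge `k`. -/
def incidence {T : ℕ} (x : Fin (T + 1) → ℝ) : Matrix (Fin (T + 1)) (Fin T) ℝ :=
  Matrix.of fun s k =>
    (Pi.single ((edges x).getD k (0, 0)).1 1 - Pi.single ((edges x).getD k (0, 0)).2 1 :
      Fin (T + 1) → ℝ) s

/-! ### From storage rates to cycle depths -/

/-- The `T × (T+1)` difference matrix `A`, so that `(A x)_t = x_{t+1} - x_t`. -/
def diffMatrix (T : ℕ) : Matrix (Fin T) (Fin (T + 1)) ℝ :=
  Matrix.of fun t k => if k = t.succ then 1 else if k = t.castSucc then -1 else 0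

/-- The Moore-Penrose inverse `A† = Aᵀ (A Aᵀ)⁻¹` of the matrix `A`, which has full row rank; see
`diffMatrix_mul_diffPinv` and `diffPinv_mul_diffMatrix_symm`. -/
def diffPinv (T : ℕ) : Matrix (Fin (T + 1)) (Fin T) ℝ :=
  (diffMatrix T)ᵀ * (diffMatrix T * (diffMatrix T)ᵀ)⁻¹

/-- The SoC profile of a storage unit with capacity `E` and initial SoC `x₀` under the discharge
rates `u`: `x_0 = x₀` and `x_t = x_{t-1} - u_t / E`. The rate of period `t + 1` is `u t`. -/
def soc {T : ℕ} (E x₀ : ℝ) (u : Fin T → ℝ) (t : Fin (T + 1)) : ℝ :=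
  x₀ - 1 / E * ∑ s : Fin T with s.castSucc < t, u s

/-- The matrix `N(u) = -(1/E) M(x)ᵀ A†`, where `x` is the SoC profile of `u`. -/
def rateMatrix {T : ℕ} (E x₀ : ℝ) (u : Fin T → ℝ) : Matrix (Fin T) (Fin T) ℝ :=
  -(1 / E) • ((incidence (soc E x₀ u))ᵀ * diffPinv T)

/-- All the matrices `N_k(u)` associated with `u`: those which are the matrix `N(v)` for all `v` in
some open set that has `u` in its closure (only `N(u)` itself if `N` is constant near `u`). -/
def associatedMatrices {T : ℕ} (E x₀ : ℝ) (u : Fin T → ℝ) : Set (Matrix (Fin T) (Fin T) ℝ) :=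
  {B | u ∈ closure (interior {v | rateMatrix E x₀ v = B})}

/-- The lower triangular `T × T` matrix `Ã`. -/
def cumMatrix (T : ℕ) (E : ℝ) : Matrix (Fin T) (Fin T) ℝ :=
  Matrix.of fun t s => if s ≤ t then 1 / E else 0

/-! ### The dispatch problem -/

/-- The data of the dispatch problem: generators `G`, storage units `S`, and `T` time periods. -/
structure Data (G S : Type*) (T : ℕ) where
  /-- the inelastic demand -/
  d : Fin T → ℝ
  /-- the bids of the generators -/
  α : G → ℝ
  α_pos : ∀ j, 0 < α j
  /-- the bids of the storage units -/
  β : S → ℝ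
  β_pos : ∀ i, 0 < β i
  /-- the generation limits -/
  gLo : G → ℝ
  gHi : G → ℝ
  /-- the rate limits of the storage units -/
  uLo : S → ℝ
  uHi : S → ℝ
  /-- the storage capacities -/
  E : S → ℝ
  E_pos : ∀ i, 0 < E i
  /-- the initial (and terminal) SoC of the storage units -/
  x₀ : S → ℝ

/-- A point `(g, u, ν)`: generation, storage rates, and cycle depths. -/
abbrev Point (G S : Type*) (T : ℕ) : Type _ :=
  (G → Fin T → ℝ) × (S → Fin T → ℝ) × (S → Fin T → ℝ)

/-- Dual variables of all the constraints of the dispatch problem. -/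
structure Multipliers (G S : Type*) (T : ℕ) where
  /-- market-clearing prices: dual variable of the power balance -/
  lam : Fin T → ℝ
  /-- per-cycle prices: dual variable of the Rainflow constraint -/
  θ : S → Fin T → ℝ
  /-- dual variable of the periodicity constraint -/
  δ : S → ℝ
  /-- dual variables of the generation limits -/
  ηLo : G → Fin T → ℝ
  ηHi : G → Fin T → ℝ
  /-- dual variables of the SoC limits -/
  μLo : S → Fin T → ℝ
  μHi : S → Fin T → ℝ
  /-- dual variables of the rate limits -/
  κLo : S → Fin T → ℝ
  κHi : S → Fin T → ℝ

namespace Data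

variable {G S : Type*} [Fintype G] [Fintype S] {T : ℕ} (D : Data G S T)

/-- The objective `∑ᵢ (1/2βᵢ) νᵢᵀνᵢ + ∑ⱼ (1/2αⱼ) gⱼᵀgⱼ`. -/
def cost (z : Point G S T) : ℝ :=
  ∑ i, 1 / (2 * D.β i) * (z.2.2 i ⬝ᵥ z.2.2 i) + ∑ j, 1 / (2 * D.α j) * (z.1 j ⬝ᵥ z.1 j)

/-- The cycle depths `N(uᵢ)uᵢ` of storage unit `i` at the rates `v`. -/
def cycleDepths (i : S) (v : Fin T → ℝ) : Fin T → ℝ :=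
  rateMatrix (D.E i) (D.x₀ i) v *ᵥ v

/-- The constraints at the point `(g, u, ν)`. -/
structure IsFeasible (z : Point G S T) : Prop where
  rainflow : ∀ i, z.2.2 i = D.cycleDepths i (z.2.1 i)
  gen_limit : ∀ j t, D.gLo j ≤ z.1 j t ∧ z.1 j t ≤ D.gHi j
  rate_limit : ∀ i t, D.uLo i ≤ z.2.1 i t ∧ z.2.1 i t ≤ D.uHi i
  periodic : ∀ i, ∑ t, z.2.1 i t = 0
  soc_limit : ∀ i t, D.x₀ i - 1 ≤ (cumMatrix T (D.E i) *ᵥ z.2.1 i) t ∧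
    (cumMatrix T (D.E i) *ᵥ z.2.1 i) t ≤ D.x₀ i
  balance : D.d = ∑ j, z.1 j + ∑ i, z.2.1 i

/-- The feasible set of the dispatch problem. -/
def feasibleSet : Set (Point G S T) := {z | D.IsFeasible z}

/-- `z` is a local minimizer of the dispatch problem. -/
def IsLocalSolution (z : Point G S T) : Prop :=
  z ∈ D.feasibleSet ∧ IsLocalMinOn D.cost D.feasibleSet z

/-- `z` is a global minimizer of the dispatch problem. -/
def IsGlobalSolution (z : Point G S T) : Prop :=
  z ∈ D.feasibleSet ∧ IsMinOn D.cost D.feasibleSet z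

/-- Dual feasibility: the dual variables of the inequality constraints are nonnegative. -/
structure DualFeasible (m : Multipliers G S T) : Prop where
  ηLo : ∀ j t, 0 ≤ m.ηLo j t
  ηHi : ∀ j t, 0 ≤ m.ηHi j t
  μLo : ∀ i t, 0 ≤ m.μLo i t
  μHi : ∀ i t, 0 ≤ m.μHi i t
  κLo : ∀ i t, 0 ≤ m.κLo i t
  κHi : ∀ i t, 0 ≤ m.κHi i t

/-- Complementary slackness. -/
structure CompSlack (z : Point G S T) (m : Multipliers G S T) : Prop where
  ηLo : ∀ j, m.ηLo j ⬝ᵥ (fun t => D.gLo j - z.1 j t) = 0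
  ηHi : ∀ j, m.ηHi j ⬝ᵥ (fun t => z.1 j t - D.gHi j) = 0
  μLo : ∀ i, m.μLo i ⬝ᵥ (fun t => D.x₀ i - 1 - (cumMatrix T (D.E i) *ᵥ z.2.1 i) t) = 0
  μHi : ∀ i, m.μHi i ⬝ᵥ (fun t => (cumMatrix T (D.E i) *ᵥ z.2.1 i) t - D.x₀ i) = 0
  κLo : ∀ i, m.κLo i ⬝ᵥ (fun t => D.uLo i - z.2.1 i t) = 0
  κHi : ∀ i, m.κHi i ⬝ᵥ (fun t => z.2.1 i t - D.uHi i) = 0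

/-- Stationarity. The Rainflow constraint contributes to the condition for `uᵢ` a convex combination
of the vectors `N_k(uᵢ)ᵀθᵢ` over the matrices `N_k(uᵢ)` associated with `uᵢ`. -/
structure Stationary (z : Point G S T) (m : Multipliers G S T) : Prop where
  gen : ∀ j, m.lam = (1 / D.α j) • z.1 j + m.ηHi j - m.ηLo j
  depth : ∀ i, m.θ i = (1 / D.β i) • z.2.2 i
  rate : ∀ i, ∃ w ∈ convexHull ℝ
      ((fun B : Matrix (Fin T) (Fin T) ℝ => Bᵀ *ᵥ m.θ i) ''
        associatedMatrices (D.E i) (D.x₀ i) (z.2.1 i)),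
    m.lam = w + (fun _ => m.δ i) + (cumMatrix T (D.E i))ᵀ *ᵥ (m.μHi i - m.μLo i)
      + m.κHi i - m.κLo i

/-- `z`, with prices and the other dual variables `m`, is a locally optimal solution: a local
minimizer that satisfies the KKT conditions with `m`. -/
structure IsLocallyOptimal (z : Point G S T) (m : Multipliers G S T) : Prop where
  primal : D.IsLocalSolution z
  stationary : D.Stationary z m
  dual : DualFeasible m
  slack : D.CompSlack z m

/-- The Lagrangian of the dispatch problem. -/
def lagrangian (z : Point G S T) (m : Multipliers G S T) : ℝ :=
  D.cost z
    + m.lam ⬝ᵥ (D.d - ∑ j, z.1 j - ∑ i, z.2.1 i)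
    + ∑ i, m.θ i ⬝ᵥ (D.cycleDepths i (z.2.1 i) - z.2.2 i)
    + ∑ i, m.δ i * ∑ t, z.2.1 i t
    + ∑ j, (m.ηLo j ⬝ᵥ (fun t => D.gLo j - z.1 j t) + m.ηHi j ⬝ᵥ (fun t => z.1 j t - D.gHi j))
    + ∑ i, (m.μLo i ⬝ᵥ (fun t => D.x₀ i - 1 - (cumMatrix T (D.E i) *ᵥ z.2.1 i) t)
        + m.μHi i ⬝ᵥ (fun t => (cumMatrix T (D.E i) *ᵥ z.2.1 i) t - D.x₀ i))
    + ∑ i, (m.κLo i ⬝ᵥ (fun t => D.uLo i - z.2.1 i t)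
        + m.κHi i ⬝ᵥ (fun t => z.2.1 i t - D.uHi i))

/-- `z`, with prices and the other dual variables `m`, is a globally optimal solution: a global
minimizer, with Lagrange multipliers `m` in the global sense, so that `z` minimizes the Lagrangian
over all points (there is no duality gap, and `m` is optimal in the dual problem). -/
structure IsGloballyOptimal (z : Point G S T) (m : Multipliers G S T) : Prop where
  primal : D.IsGlobalSolution z
  lagrangian_min : ∀ z' : Point G S T, D.lagrangian z m ≤ D.lagrangian z' m
  dual : DualFeasible m
  slack : D.CompSlack z m

end Data

/-! ### Facts about the matrix `A` and its pseudoinverse -/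

/-- The matrix form `A x = -(1/E) u` of the SoC evolution. -/
theorem diffMatrix_mulVec_soc {T : ℕ} (E x₀ : ℝ) (u : Fin T → ℝ) :
    diffMatrix T *ᵥ soc E x₀ u = -(1 / E) • u := by
  funext t
  have h1 : (diffMatrix T *ᵥ soc E x₀ u) t = soc E x₀ u t.succ - soc E x₀ u t.castSucc := by
    have hne : t.succ ≠ t.castSucc := by simp [Fin.ext_iff]
    have h : ∀ k, diffMatrix T t k * soc E x₀ u k
        = (if k = t.succ then soc E x₀ u k else 0) - (if k = t.castSucc then soc E x₀ u k else 0) := by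
      intro k
      by_cases hk : k = t.succ
      · subst hk; simp [diffMatrix, hne]
      · by_cases hk' : k = t.castSucc
        · subst hk'; simp [diffMatrix, hne.symm]
        · simp [diffMatrix, hk, hk']
    simp [Matrix.mulVec, dotProduct, h, Finset.sum_sub_distrib]
  have h2 : (Finset.univ.filter fun s : Fin T => s.castSucc < t.succ)
      = insert t (Finset.univ.filter fun s : Fin T => s.castSucc < t.castSucc) := by
    ext s
    simp only [Finset.mem_filter, Finset.mem_univ, true_and, Finset.mem_insert, Fin.lt_def,
      Fin.ext_iff, Fin.val_castSucc, Fin.val_succ]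
    omega
  rw [h1]
  unfold soc
  rw [h2, Finset.sum_insert (by simp)]
  simp only [Pi.smul_apply, smul_eq_mul]
  ring

theorem diffMatrix_mul_diffPinv (T : ℕ) : diffMatrix T * diffPinv T = 1 := by
  have hinj : Function.Injective (diffMatrix T).vecMul := by
    intro v w hvw
    have h : ∀ u : Fin T → ℝ, v ⬝ᵥ u = w ⬝ᵥ u := by
      intro u
      have hu : diffMatrix T *ᵥ soc (-1) 0 u = u := by
        rw [diffMatrix_mulVec_soc]; simp
      rw [← hu, Matrix.dotProduct_mulVec, Matrix.dotProduct_mulVec]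
      exact congrArg (· ⬝ᵥ soc (-1) 0 u) hvw
    funext t
    simpa using h (Pi.single t 1)
  have hpos := Matrix.PosDef.mul_conjTranspose_self (diffMatrix T) hinj
  rw [Matrix.conjTranspose_eq_transpose_of_trivial] at hpos
  rw [diffPinv, ← Matrix.mul_assoc]
  exact Matrix.mul_nonsing_inv _ ((Matrix.isUnit_iff_isUnit_det _).mp hpos.isUnit)

theorem diffPinv_mul_diffMatrix_symm (T : ℕ) :
    (diffPinv T * diffMatrix T)ᵀ = diffPinv T * diffMatrix T := by
  simp only [diffPinv, Matrix.transpose_mul, Matrix.transpose_nonsing_inv,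
    Matrix.transpose_transpose, Matrix.mul_assoc]

end

end CycleAware

namespace CycleAware

noncomputable section

open scoped Matrix Topology

/-! ### Truncated variation -/

/-! Although the graph of the Rainflow map is not convex, eliminating `ν` leaves a convex problem in
`(g, u)`. The reason is a variational description of the counted depths: for every threshold `κ ≥
0`, the sum of `max (depth - κ) 0` over the half-cycles is the truncated variation of the profile,
the maximum of `∑ max (|Δ| - κ) 0` over all subsequences of times starting at `0`
(`sum_halfCycles`). Dropping a non-turning point leaves this maximum unchanged, extracting a full
cycle lowers it by exactly two half-cycles (`IsPlay.visit_fullCycle`), and when no full cycle is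
left it is best to visit every node.

A maximum of sums of jointly convex terms is jointly convex in `κ` and the profile
(`truncVar_convex`). The sum of the largest depths is a minimum over `κ` of such a function plus a
linear term, so it is convex (`sum_tail_convex`). By Abel summation every nonnegative nondecreasing
weighting of the sorted depths is convex, and so is the sum of their squares.

Hence the reduced cost is convex; `ν` depends continuously on `u`, so local minimality passes to the
reduced problem, which gives the first claim. For the second, `θ = ν / β` is itself nonnegative and
nondecreasing, so `θ ⬝ᵥ N(u)u` is convex in `u` and the vectors `N_kᵀ θ` are subgradients of it.
Stationarity then makes each separate term of the Lagrangian minimal. -/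

/-- The part of `t` above the threshold `κ`. -/
def trunc (κ t : ℝ) : ℝ := max (t - κ) 0

theorem trunc_nonneg (κ t : ℝ) : 0 ≤ trunc κ t := le_max_right _ _

theorem sub_le_trunc (κ t : ℝ) : t - κ ≤ trunc κ t := le_max_left _ _

theorem trunc_zero {κ : ℝ} (hκ : 0 ≤ κ) : trunc κ 0 = 0 := by simp [trunc, hκ]

theorem trunc_mono (κ : ℝ) {s t : ℝ} (h : s ≤ t) : trunc κ s ≤ trunc κ t :=
  max_le_max (by linarith) le_rfl

theorem trunc_le_add (κ : ℝ) {s t r : ℝ} (hr : 0 ≤ r) (h : s ≤ t + r) :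
    trunc κ s ≤ trunc κ t + r :=
  max_le (by linarith [sub_le_trunc κ t]) (by linarith [trunc_nonneg κ t])

/-- Convexity of `trunc κ` in majorization form: of two pairs with equal sum, the more spread one
has the larger total. -/
theorem trunc_spread (κ : ℝ) {p q r s : ℝ} (hps : p ≤ s) (hqs : q ≤ s)
    (h : p + q = r + s) : trunc κ p + trunc κ q ≤ trunc κ r + trunc κ s := by
  have := sub_le_trunc κ r
  have := trunc_nonneg κ r
  have := sub_le_trunc κ s
  have := trunc_nonneg κ s
  have h1 := trunc_mono κ hps
  have h2 := trunc_mono κ hqs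
  rcases max_choice (p - κ) 0 with hp | hp <;> rcases max_choice (q - κ) 0 with hq | hq <;>
    simp only [trunc] at * <;> linarith

/-- A function that decreases with slope `-1`, is constant, and then increases with slope `1`
(each of the parts may be missing). -/
structure IsPlay (f : ℝ → ℝ) : Prop where
  lip : ∀ y z, f y ≤ f z + |y - z|
  left : ∀ y, (∀ z ≤ y, f y + (y - z) ≤ f z) ∨ ∀ z, y ≤ z → f y ≤ f z
  right : ∀ y, (∀ z, y ≤ z → f y + (z - y) ≤ f z) ∨ ∀ z ≤ y, f y ≤ f z

namespace IsPlay

theorem const (k : ℝ) : IsPlay fun _ => k where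
  lip y z := by linarith [abs_nonneg (y - z)]
  left y := Or.inr fun _ _ => le_rfl
  right y := Or.inr fun _ _ => le_rfl

theorem max {f g : ℝ → ℝ} (hf : IsPlay f) (hg : IsPlay g) : IsPlay fun y => max (f y) (g y) where
  lip y z := max_le ((hf.lip y z).trans (by gcongr; exact le_max_left _ _))
    ((hg.lip y z).trans (by gcongr; exact le_max_right _ _))
  left y := by
    rcases max_choice (f y) (g y) with h | h <;> rw [h]
    · exact (hf.left y).imp (fun H z hz => (H z hz).trans (le_max_left _ _))
        (fun H z hz => (H z hz).trans (le_max_left _ _))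
    · exact (hg.left y).imp (fun H z hz => (H z hz).trans (le_max_right _ _))
        (fun H z hz => (H z hz).trans (le_max_right _ _))
  right y := by
    rcases max_choice (f y) (g y) with h | h <;> rw [h]
    · exact (hf.right y).imp (fun H z hz => (H z hz).trans (le_max_left _ _))
        (fun H z hz => (H z hz).trans (le_max_left _ _))
    · exact (hg.right y).imp (fun H z hz => (H z hz).trans (le_max_right _ _))
        (fun H z hz => (H z hz).trans (le_max_right _ _))

theorem comp_neg {f : ℝ → ℝ} (hf : IsPlay f) : IsPlay fun y => f (-y) where
  lip y z := by
    have := hf.lip (-y) (-z)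
    rwa [← abs_neg, neg_sub_neg, neg_sub] at this
  left y := (hf.right (-y)).imp
    (fun H z hz => by have := H (-z) (by linarith); linarith) (fun H z hz => H _ (by linarith))
  right y := (hf.left (-y)).imp
    (fun H z hz => by have := H (-z) (by linarith); linarith) (fun H z hz => H _ (by linarith))

theorem add_id (k : ℝ) : IsPlay fun y => k + y where
  lip y z := by linarith [le_abs_self (y - z)]
  left y := Or.inr fun z hz => by linarith
  right y := Or.inl fun z hz => by linarith

theorem trunc_dist (κ b k : ℝ) : IsPlay fun y => trunc κ |y - b| + k := by
  -- The three affine pieces of `y ↦ trunc κ |y - b| + k`: slope `1`, slope `-1`, and the constant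
  -- `k`.
  have h := ((add_id (k - κ - b)).max (add_id (k - κ + b)).comp_neg).max (const k)
  convert h using 2 with y
  simp only [trunc, abs_eq_max_neg, max_add, ← max_sub_sub_right]
  congr 1
  · congr 1 <;> ring
  · ring

/-- A function of this shape is quasiconvex. -/
theorem le_max_of_between {f : ℝ → ℝ} (hf : IsPlay f) {a b c : ℝ} (hab : a ≤ b) (hbc : b ≤ c) :
    f b ≤ Max.max (f a) (f c) := by
  rcases hf.left b with h | h
  · exact le_max_of_le_left (by linarith [h a hab])
  · exact le_max_of_le_right (h c hbc)

end IsPlay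

/-! ### Deleting nodes from the dynamic program of the truncated variation -/

/-- The best value from `y` when the node `b` may be visited first: `f` is the value of the rest,
and a step of length `t` has the value `trunc κ t`. -/
def visit (κ b : ℝ) (f : ℝ → ℝ) (y : ℝ) : ℝ := max (f y) (trunc κ |y - b| + f b)

theorem IsPlay.visit {f : ℝ → ℝ} (hf : IsPlay f) (κ b : ℝ) : IsPlay (visit κ b f) :=
  hf.max (IsPlay.trunc_dist κ b (f b))

theorem le_visit (κ b : ℝ) (f : ℝ → ℝ) (y : ℝ) : f y ≤ visit κ b f y := le_max_left _ _

theorem step_le_visit (κ b : ℝ) (f : ℝ → ℝ) (y : ℝ) :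
    trunc κ |y - b| + f b ≤ visit κ b f y := le_max_right _ _

theorem visit_neg (κ b : ℝ) (f : ℝ → ℝ) (y : ℝ) :
    visit κ (-b) (fun y => f (-y)) y = visit κ b f (-y) := by
  simp only [visit, neg_neg]
  rw [← abs_neg (y - -b), neg_sub, show -b - y = -y - b by ring]

theorem visit_self {κ : ℝ} (hκ : 0 ≤ κ) (a : ℝ) (f : ℝ → ℝ) : visit κ a f a = f a := by
  simp [visit, trunc_zero hκ]

theorem trunc_le_self {κ t : ℝ} (hκ : 0 ≤ κ) (ht : 0 ≤ t) : trunc κ t ≤ t :=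
  max_le (by linarith) ht

theorem trunc_add_le {κ s t : ℝ} (hκ : 0 ≤ κ) (hs : 0 ≤ s) (ht : 0 ≤ t) :
    trunc κ s + trunc κ t ≤ trunc κ (s + t) := by
  have := trunc_spread κ (p := s) (q := t) (r := 0) (s := s + t) (by linarith) (by linarith)
    (by ring)
  rwa [trunc_zero hκ, zero_add] at this

/-- Stopping at `b` on the way towards `c` is never needed. If `f` has slope `-1` to the left of
`b`, then staying at `y` already gains the whole distance; otherwise `f b ≤ f c`, and the longer
step to `c` is at least as good. -/
theorem IsPlay.step_le_visit_of_le {f : ℝ → ℝ} (hf : IsPlay f) {κ y b c : ℝ} (hκ : 0 ≤ κ)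
    (hyb : y ≤ b) (hbc : b ≤ c) : trunc κ |y - b| + f b ≤ CycleAware.visit κ c f y := by
  rcases hf.left b with h | h
  · refine le_trans ?_ (le_visit κ c f y)
    have := trunc_le_self hκ (abs_nonneg (y - b))
    rw [abs_of_nonpos (by linarith)] at this ⊢
    linarith [h y hyb]
  · refine le_trans ?_ (CycleAware.step_le_visit κ c f y)
    rw [abs_of_nonpos (by linarith), abs_of_nonpos (by linarith)]
    exact add_le_add (trunc_mono κ (by linarith)) (h c hbc)

theorem IsPlay.step_le_visit_of_ge {f : ℝ → ℝ} (hf : IsPlay f) {κ y b c : ℝ} (hκ : 0 ≤ κ)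
    (hyb : b ≤ y) (hbc : c ≤ b) : trunc κ |y - b| + f b ≤ CycleAware.visit κ c f y := by
  have h := hf.comp_neg.step_le_visit_of_le (y := -y) (b := -b) (c := -c) hκ (by linarith)
    (by linarith)
  rw [visit_neg, neg_neg, neg_neg, ← abs_neg] at h
  rwa [show y - b = -(-y - -b) by ring]

/-- The new case is a path through both `b` and `c`: two steps in the same direction merge into one,
since `trunc κ` is superadditive. -/
theorem IsPlay.step_visit_le {f : ℝ → ℝ} (hf : IsPlay f) {κ y b c : ℝ} (hκ : 0 ≤ κ)
    (hyb : y ≤ b) (hbc : b ≤ c) :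
    trunc κ |y - b| + CycleAware.visit κ c f b ≤ CycleAware.visit κ c f y := by
  rcases max_choice (f b) (trunc κ |b - c| + f c) with h | h <;>
    rw [CycleAware.visit.eq_1 κ c f b, h]
  · exact hf.step_le_visit_of_le hκ hyb hbc
  · refine le_trans ?_ (CycleAware.step_le_visit κ c f y)
    rw [abs_of_nonpos (by linarith), abs_of_nonpos (by linarith), abs_of_nonpos (by linarith)]
    have := trunc_add_le hκ (s := -(y - b)) (t := -(b - c)) (by linarith) (by linarith)
    rw [show -(y - b) + -(b - c) = -(y - c) by ring] at this
    linarith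

/-- A node between its two neighbours may be skipped. -/
theorem IsPlay.step_le_visit_visit {f : ℝ → ℝ} (hf : IsPlay f) {κ a b c : ℝ} (hκ : 0 ≤ κ)
    (hab : a ≤ b) (hbc : b ≤ c) (y : ℝ) :
    trunc κ |y - b| + CycleAware.visit κ c f b
      ≤ CycleAware.visit κ a (CycleAware.visit κ c f) y := by
  rcases le_total y b with h | h
  · exact (hf.step_visit_le hκ h hbc).trans (le_visit _ _ _ _)
  · exact (hf.visit κ c).step_le_visit_of_ge hκ h hab

theorem IsPlay.visit_between {f : ℝ → ℝ} (hf : IsPlay f) {κ a b c : ℝ} (hκ : 0 ≤ κ)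
    (hab : a ≤ b) (hbc : b ≤ c) (y : ℝ) :
    CycleAware.visit κ a (CycleAware.visit κ b (CycleAware.visit κ c f)) y
      = CycleAware.visit κ a (CycleAware.visit κ c f) y := by
  set F := CycleAware.visit κ c f with hF
  have hle : ∀ y, CycleAware.visit κ b F y ≤ CycleAware.visit κ a F y := fun y =>
    max_le (le_visit _ _ _ _) (hf.step_le_visit_visit hκ hab hbc y)
  refine le_antisymm (max_le (hle y) ?_) (max_le_max (le_visit _ _ _ _) ?_)
  -- At the value `a` the node `a` is free, so this says that `b` brings no gain after `a`.
  · have := hle a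
    rw [visit_self hκ] at this
    exact le_trans (by gcongr) (CycleAware.step_le_visit κ a F y)
  · gcongr
    exact le_visit _ _ _ _

theorem IsPlay.visit_between' {f : ℝ → ℝ} (hf : IsPlay f) {κ a b c : ℝ} (hκ : 0 ≤ κ)
    (hab : b ≤ a) (hbc : c ≤ b) (y : ℝ) :
    CycleAware.visit κ a (CycleAware.visit κ b (CycleAware.visit κ c f)) y
      = CycleAware.visit κ a (CycleAware.visit κ c f) y := by
  have h := hf.comp_neg.visit_between (a := -a) (b := -b) (c := -c) hκ (by linarith)
    (by linarith) (-y)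
  have e : ∀ b g, CycleAware.visit κ (-b) (fun y => g (-y))
      = fun y => CycleAware.visit κ b g (-y) := fun b g => funext fun y => visit_neg κ b g y
  simp only [e, neg_neg] at h
  exact h

/-- Removal of a full cycle. -/
theorem IsPlay.visit_fullCycle {f : ℝ → ℝ} (hf : IsPlay f) {κ a b c d : ℝ} (hκ : 0 ≤ κ)
    (hac : a ≤ c) (hcb : c ≤ b) (hbd : b ≤ d) (y : ℝ) :
    CycleAware.visit κ a (CycleAware.visit κ b (CycleAware.visit κ c (CycleAware.visit κ d f))) y
      = 2 * trunc κ (b - c) + CycleAware.visit κ a (CycleAware.visit κ d f) y := by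
  set F := CycleAware.visit κ d f with hF
  have hFp : IsPlay F := hf.visit κ d
  set G := CycleAware.visit κ b (CycleAware.visit κ c F) with hG
  have he := trunc_nonneg κ (b - c)
  have skip : ∀ y, F y ≤ G y := fun y => (le_visit _ _ _ _).trans (le_visit _ _ _ _)
  have pathb : ∀ y, trunc κ |y - b| + F b ≤ G y := fun y =>
    le_trans (by gcongr; exact le_visit _ _ _ _) (CycleAware.step_le_visit _ _ _ _)
  have pathbc : ∀ y, trunc κ |y - b| + trunc κ (b - c) + F c ≤ G y := fun y => by
    have h1 := CycleAware.step_le_visit κ b (CycleAware.visit κ c F) y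
    have h2 := CycleAware.step_le_visit κ c F b
    rw [abs_of_nonneg (by linarith : 0 ≤ b - c)] at h2
    linarith
  -- upper bound
  have up : ∀ y, G y ≤ 2 * trunc κ (b - c) + CycleAware.visit κ a F y := by
    intro y
    have hb : trunc κ |y - b| + F b ≤ CycleAware.visit κ a F y :=
      hf.step_le_visit_visit hκ (hac.trans hcb) hbd y
    have hc : trunc κ |y - c| + F c ≤ CycleAware.visit κ a F y :=
      hf.step_le_visit_visit hκ hac (hcb.trans hbd) y
    have h0 := le_visit κ a F y
    have ha := CycleAware.step_le_visit κ a F y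
    -- Only the path through both `b` and `c` can use the two extra half-cycles; every other path
    -- avoids one of these nodes and is covered by skipping it.
    have hbc : trunc κ |y - b| + (trunc κ |b - c| + F c)
        ≤ 2 * trunc κ (b - c) + CycleAware.visit κ a F y := by
      rw [abs_of_nonneg (by linarith : 0 ≤ b - c)]
      rcases le_total y c with hyc | hyc
      · suffices trunc κ |y - b| + F c ≤ trunc κ (b - c) + F y by linarith
        rw [abs_of_nonpos (by linarith)]
        rcases max_choice (f c) (trunc κ |c - d| + f d) with h | h <;>
          rw [hF, CycleAware.visit.eq_1 κ d f c, h, ← hF]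
        · rcases hf.left c with h' | h'
          · have := trunc_le_add κ (s := -(y - b)) (t := b - c) (r := c - y) (by linarith)
              (by linarith)
            linarith [h' y hyc, le_visit κ d f y]
          · have h1 := CycleAware.step_le_visit κ d f y
            have h2 := trunc_mono κ (s := -(y - b)) (t := |y - d|)
              (by rw [abs_of_nonpos (by linarith)]; linarith)
            linarith [h' d (by linarith)]
        -- The lengths of `[y, b]` and `[c, d]` add up to those of `[c, b]` and `[y, d]`, and the
        -- latter pair is more spread.
        · have h1 := CycleAware.step_le_visit κ d f y
          rw [abs_of_nonpos (by linarith)] at h1 ⊢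
          have := trunc_spread κ (p := -(y - b)) (q := -(c - d)) (r := b - c) (s := -(y - d))
            (by linarith) (by linarith) (by ring)
          linarith
      · rcases hFp.right c with h | h
        · have h1 := h y hyc
          have : trunc κ |y - b| ≤ trunc κ (b - c) + (y - c) :=
            trunc_le_add κ (by linarith) (abs_le.2 ⟨by linarith, by linarith⟩)
          linarith
        · have h1 := h a hac
          have : trunc κ |y - b| ≤ trunc κ (b - c) + trunc κ |y - a| := by
            rcases le_total y b with hyb | hyb
            · have := trunc_mono κ (s := |y - b|) (t := b - c)
                (by rw [abs_of_nonpos (by linarith)]; linarith)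
              linarith [trunc_nonneg κ |y - a|]
            · have := trunc_mono κ (s := |y - b|) (t := |y - a|)
                (by rw [abs_of_nonneg (by linarith), abs_of_nonneg (by linarith)]; linarith)
              linarith
          linarith
    refine max_le (max_le (by linarith) (by linarith)) ?_
    change trunc κ |y - b| + Max.max (F b) (trunc κ |b - c| + F c) ≤ _
    rw [← max_add_add_left]
    exact max_le (by linarith) hbc
  -- lower bound
  have low : ∀ y ≤ c, 2 * trunc κ (b - c) + F y ≤ G y := by
    intro y hyc
    -- A cycle no deeper than `κ` is worth nothing, so skipping it suffices. A deeper one is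
    -- collected by the path `y → b → c`, and the Lipschitz bound compares `F c` with `F y`.
    rcases le_total (b - c) κ with hk | hk
    · rw [trunc, max_eq_right (by linarith)]
      linarith [skip y]
    have h1 := pathbc y
    have h2 := sub_le_trunc κ |y - b|
    rw [abs_of_nonpos (by linarith)] at h1 h2
    have e : trunc κ (b - c) = b - c - κ := max_eq_left (by linarith)
    rw [e] at h1 ⊢
    have h3 := hFp.lip y c
    rw [abs_of_nonpos (by linarith)] at h3
    linarith
  have lowa := low a hac
  refine le_antisymm (max_le (up y) ?_) ?_
  · have h := up a
    rw [visit_self hκ] at h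
    linarith [CycleAware.step_le_visit κ a F y]
  · rw [CycleAware.visit.eq_1 κ a F y, ← max_add_add_left]
    have stepa := CycleAware.step_le_visit κ a G y
    refine max_le ?_ (by linarith)
    rcases le_total y c with hyc | hyc
    · exact (low y hyc).trans (le_visit _ _ _ _)
    -- If `F` climbs with slope `1` to the right of `y`, the path `y → a → b` gains enough because
    -- `a ≤ c`. Otherwise `F y ≤ F a`, and the bound at `a` applies after a step to `a`.
    rcases hFp.right y with h | h
    · rcases le_total (b - c) κ with hk | hk
      · rw [trunc, max_eq_right (by linarith)]
        linarith [skip y, le_visit κ a G y]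
      have e : trunc κ (b - c) = b - c - κ := max_eq_left (by linarith)
      rw [e]
      have h1 := pathb a
      have h2 := sub_le_trunc κ |a - b|
      have h3 := sub_le_trunc κ |y - a|
      rw [abs_of_nonpos (by linarith)] at h1 h2
      rw [abs_of_nonneg (by linarith)] at h3
      have h4 : F y ≤ F b + (y - b) := by
        rcases le_total y b with hyb | hyb
        · linarith [h b hyb]
        · have := hFp.lip y b
          rwa [abs_of_nonneg (by linarith)] at this
      rw [abs_of_nonneg (by linarith : 0 ≤ y - a)] at stepa
      linarith
    · linarith [h a (by linarith), trunc_nonneg κ |y - a|]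

theorem IsPlay.visit_fullCycle' {f : ℝ → ℝ} (hf : IsPlay f) {κ a b c d : ℝ} (hκ : 0 ≤ κ)
    (hac : c ≤ a) (hcb : b ≤ c) (hbd : d ≤ b) (y : ℝ) :
    CycleAware.visit κ a (CycleAware.visit κ b (CycleAware.visit κ c (CycleAware.visit κ d f))) y
      = 2 * trunc κ (c - b) + CycleAware.visit κ a (CycleAware.visit κ d f) y := by
  have h := hf.comp_neg.visit_fullCycle (a := -a) (b := -b) (c := -c) (d := -d) hκ (by linarith)
    (by linarith) (by linarith) (-y)
  have e : ∀ b g, CycleAware.visit κ (-b) (fun y => g (-y))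
      = fun y => CycleAware.visit κ b g (-y) := fun b g => funext fun y => visit_neg κ b g y
  simp only [e, neg_neg] at h
  rw [h]
  ring_nf

/-! ### The Rainflow algorithm computes truncated variations -/

section RainflowVariation

variable {ι : Type*}

/-- The largest sum `∑ trunc κ |Δ|` over the steps of the paths that start at the value `y` and then
visit the nodes of a sublist of `l` (truncated variation). -/
def truncVar (κ : ℝ) (x : ι → ℝ) (l : List ι) : ℝ → ℝ :=
  l.foldr (fun a f => visit κ (x a) f) fun _ => 0

theorem truncVar_cons (κ : ℝ) (x : ι → ℝ) (a : ι) (l : List ι) :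
    truncVar κ x (a :: l) = visit κ (x a) (truncVar κ x l) := rfl

theorem isPlay_truncVar (κ : ℝ) (x : ι → ℝ) (l : List ι) : IsPlay (truncVar κ x l) := by
  induction l with
  | nil => exact IsPlay.const 0
  | cons a l ih => exact ih.visit κ (x a)

/-- The values of `x` along the list go up and down alternately. -/
def Zigzag (x : ι → ℝ) : List ι → Prop
  | a :: b :: c :: l =>
      (x b < x a ∧ x b < x c ∨ x a < x b ∧ x c < x b) ∧ Zigzag x (b :: c :: l)
  | _ => True

theorem Zigzag.tail {x : ι → ℝ} {a : ι} {l : List ι} (h : Zigzag x (a :: l)) : Zigzag x l := by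
  match l, h with
  | [], _ => trivial
  | [_], _ => trivial
  | _ :: _ :: _, h => exact h.2

theorem not_between {p q r : ℝ} (h : ¬(min p r ≤ q ∧ q ≤ max p r)) :
    q < p ∧ q < r ∨ p < q ∧ r < q := by
  rw [not_and_or, not_le, not_le, lt_min_iff, max_lt_iff] at h
  exact h

/-- When `b` is dropped, `c` remains a strict extremum: `x b` lies between `x a` and `x c`, so `x a`
is on the same side of `x c` as `x b`. -/
theorem zigzag_addSwitch {x : ι → ℝ} (a : ι) {l : List ι} (h : Zigzag x l) :
    Zigzag x (addSwitch x a l) := by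
  match l, h with
  | [], _ => trivial
  | [_], _ => trivial
  | b :: c :: l, h =>
    rw [addSwitch]
    split_ifs with hb
    · match l, h with
      | [], _ => trivial
      | d :: l, h =>
        refine ⟨?_, h.2⟩
        have h1 := h.1
        rcases h1 with h1 | h1
        · refine Or.inl ⟨?_, h1.2⟩
          by_contra! hc
          have := hb.2
          rw [max_eq_right hc] at this
          linarith
        · refine Or.inr ⟨?_, h1.2⟩
          by_contra! hc
          have := hb.1
          rw [min_eq_right hc] at this
          linarith
    · exact ⟨not_between hb, h⟩

theorem zigzag_switchingTimes (x : ι → ℝ) (l : List ι) : Zigzag x (switchingTimes x l) := by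
  induction l with
  | nil => trivial
  | cons a l ih => exact zigzag_addSwitch a ih

theorem truncVar_addSwitch {κ : ℝ} (hκ : 0 ≤ κ) (x : ι → ℝ) (a : ι) (l : List ι) :
    truncVar κ x (addSwitch x a l) = truncVar κ x (a :: l) := by
  match l with
  | [] => rfl
  | [_] => rfl
  | b :: c :: l =>
    rw [addSwitch]
    split_ifs with hb
    · funext y
      simp only [truncVar_cons]
      have hf := isPlay_truncVar κ x l
      rcases le_total (x a) (x c) with h | h
      · rw [min_eq_left h, max_eq_right h] at hb
        exact (hf.visit_between hκ hb.1 hb.2 y).symm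
      · rw [min_eq_right h, max_eq_left h] at hb
        exact (hf.visit_between' hκ hb.2 hb.1 y).symm
    · rfl

theorem truncVar_switchingTimes {κ : ℝ} (hκ : 0 ≤ κ) (x : ι → ℝ) (l : List ι) :
    truncVar κ x (switchingTimes x l) = truncVar κ x l := by
  induction l with
  | nil => rfl
  | cons a l ih =>
    change truncVar κ x (addSwitch x a (switchingTimes x l)) = _
    rw [truncVar_addSwitch hκ, truncVar_cons, ih, truncVar_cons]

theorem exists_addSwitch_eq_cons (x : ι → ℝ) (a : ι) (l : List ι) :
    ∃ t, addSwitch x a l = a :: t ∧ t.length ≤ l.length := by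
  match l with
  | [] => exact ⟨_, rfl, le_rfl⟩
  | [_] => exact ⟨_, rfl, le_rfl⟩
  | b :: c :: l =>
    rw [addSwitch]
    split_ifs
    · exact ⟨_, rfl, by simp⟩
    · exact ⟨_, rfl, le_rfl⟩

/-- The initial node survives, so paths may start from its value at no cost (`visit_self`); the
length bound later limits the number of edges by `T`. -/
theorem exists_switchingTimes_eq_cons (x : ι → ℝ) (a : ι) (l : List ι) :
    ∃ t, switchingTimes x (a :: l) = a :: t ∧ t.length ≤ l.length := by
  induction l generalizing a with
  | nil => exact ⟨[], rfl, le_rfl⟩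
  | cons b l ih =>
    obtain ⟨t, ht, hl⟩ := ih b
    obtain ⟨s, hs, hl'⟩ := exists_addSwitch_eq_cons x a (switchingTimes x (b :: l))
    refine ⟨s, hs, hl'.trans ?_⟩
    rw [ht]
    simpa using hl

/-- The extraction of a full cycle from a zigzag list: the head is kept, the second node is moved
away from the first one, and the truncated variation drops by two half-cycles. -/
theorem findFullCycle_some {κ : ℝ} (hκ : 0 ≤ κ) {x : ι → ℝ} {l : List ι} {e : ι × ι} {l' : List ι}
    (hz : Zigzag x l) (h : findFullCycle x l = some (e, l')) :
    ∃ a b s d t, l = a :: b :: s ∧ l' = a :: d :: t ∧ l.length = l'.length + 2 ∧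
      (x a < x b → x b ≤ x d) ∧ (x b < x a → x d ≤ x b) ∧ Zigzag x l' ∧
      ∀ y, truncVar κ x l y = 2 * trunc κ (depth x e) + truncVar κ x l' y := by
  match l, hz, h with
  | a :: b :: c :: d :: l, hz, h =>
    rw [findFullCycle] at h
    split_ifs at h with hc
    · simp only [Option.some.injEq, Prod.mk.injEq] at h
      obtain ⟨rfl, rfl⟩ := h
      refine ⟨a, b, _, d, l, rfl, rfl, by simp, ?_⟩
      have hf := isPlay_truncVar κ x l
      have hzd : ∀ m l₂, l = m :: l₂ →
          (x d < x c ∧ x d < x m ∨ x c < x d ∧ x m < x d) ∧ Zigzag x (d :: m :: l₂) := by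
        rintro m l₂ rfl
        exact hz.2.2
      obtain ⟨h1, h2⟩ := hc
      rcases hz.1 with h3 | h3 <;> rcases hz.2.1 with h4 | h4 <;> try (exfalso; linarith)
      · rw [abs_of_neg (by linarith), abs_of_pos (by linarith)] at h1 h2
        refine ⟨fun _ => by linarith, fun _ => by linarith, ?_, fun y => ?_⟩
        · match l, hzd with
          | [], _ => trivial
          | m :: l, hzd =>
            obtain ⟨h5, h6⟩ := hzd m l rfl
            exact ⟨Or.inl ⟨by linarith, by rcases h5 with h5 | h5 <;> linarith⟩, h6⟩
        · rw [depth, abs_of_neg (by linarith), neg_sub]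
          exact hf.visit_fullCycle' hκ (by linarith) (by linarith) (by linarith) y
      · rw [abs_of_pos (by linarith), abs_of_neg (by linarith)] at h1 h2
        refine ⟨fun _ => by linarith, fun _ => by linarith, ?_, fun y => ?_⟩
        · match l, hzd with
          | [], _ => trivial
          | m :: l, hzd =>
            obtain ⟨h5, h6⟩ := hzd m l rfl
            exact ⟨Or.inr ⟨by linarith, by rcases h5 with h5 | h5 <;> linarith⟩, h6⟩
        · rw [depth, abs_of_pos (by linarith)]
          exact hf.visit_fullCycle hκ (by linarith) (by linarith) (by linarith) y
    · rw [Option.map_eq_some_iff] at h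
      obtain ⟨⟨e', m⟩, hm, he⟩ := h
      simp only [Prod.mk.injEq] at he
      obtain ⟨rfl, rfl⟩ := he
      obtain ⟨b', c', s, d', t, hl, rfl, hlen, hup, hdown, hz', hW⟩ :=
        findFullCycle_some hκ hz.2 hm
      simp only [List.cons.injEq] at hl
      obtain ⟨rfl, rfl, -⟩ := hl
      refine ⟨a, b, _, b, _, rfl, rfl, ?_, fun _ => le_rfl, fun _ => le_rfl, ⟨?_, hz'⟩, fun y => ?_⟩
      · simpa using hlen
      · rcases hz.1 with h3 | h3
        · exact Or.inl ⟨h3.1, h3.2.trans_le (hup h3.2)⟩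
        · exact Or.inr ⟨h3.1, (hdown h3.2).trans_lt h3.2⟩
      -- The identity `hW` holds at every starting value, so the constant passes through the outer
      -- maximum.
      · rw [truncVar_cons κ x a, truncVar_cons κ x a, visit, visit, hW, hW, ← max_add_add_left]
        congr 1
        ring

/-- Once the differences decrease in a list without full cycles, all values stay in between. -/
theorem between_of_decreasing {x : ι → ℝ} {a b c : ι} {l : List ι}
    (hz : Zigzag x (a :: b :: c :: l)) (h : findFullCycle x (a :: b :: c :: l) = none)
    (hd : |x b - x c| ≤ |x a - x b|) :
    ∀ z ∈ c :: l, min (x a) (x b) ≤ x z ∧ x z ≤ max (x a) (x b) := by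
  have hc : min (x a) (x b) ≤ x c ∧ x c ≤ max (x a) (x b) := by
    rcases hz.1 with h1 | h1
    · rw [abs_of_neg (by linarith), abs_of_pos (by linarith)] at hd
      rw [min_eq_right h1.1.le, max_eq_left h1.1.le]
      exact ⟨h1.2.le, by linarith⟩
    · rw [abs_of_pos (by linarith), abs_of_neg (by linarith)] at hd
      rw [min_eq_left h1.1.le, max_eq_right h1.1.le]
      exact ⟨by linarith, h1.2.le⟩
  intro z hzm
  rcases List.mem_cons.1 hzm with rfl | hzm
  · exact hc
  match l, hzm with
  | d :: l, hzm =>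
    rw [findFullCycle] at h
    split_ifs at h with hcyc
    rw [Option.map_eq_none_iff] at h
    -- The middle difference at `a, b, c, d` is not the smallest, so the decrease must continue.
    have hd' : |x c - x d| ≤ |x b - x c| := by
      by_contra! hlt
      exact hcyc ⟨hd, hlt.le⟩
    have := between_of_decreasing hz.2 h hd' z hzm
    exact ⟨(le_min (min_le_right _ _) hc.1).trans this.1,
      this.2.trans (max_le (le_max_right _ _) hc.2)⟩

/-- Whichever node is visited first from `p`, that step is no longer than the one from `p` to `q`;
going to `q` and continuing to the same node loses nothing. -/
theorem truncVar_le_of_near {κ : ℝ} {x : ι → ℝ} {p q : ℝ} {l : List ι}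
    (h : ∀ z ∈ l, |p - x z| ≤ |p - q|) : truncVar κ x l p ≤ trunc κ |p - q| + truncVar κ x l q := by
  induction l with
  | nil => exact add_nonneg (trunc_nonneg _ _) le_rfl
  | cons z l ih =>
    rw [truncVar_cons]
    refine max_le ((ih fun w hw => h w (List.mem_cons_of_mem _ hw)).trans
      (by gcongr; exact le_visit _ _ _ _)) ?_
    have h1 := trunc_mono κ (h z List.mem_cons_self)
    have h2 := step_le_visit κ (x z) (truncVar κ x l) q
    have h3 := trunc_nonneg κ |q - x z|
    linarith

/-- Without full cycles it is best to visit every node. -/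
theorem truncVar_cons_of_none {κ : ℝ} {x : ι → ℝ} {a b : ι} {l : List ι}
    (hz : Zigzag x (a :: b :: l)) (h : findFullCycle x (a :: b :: l) = none) :
    truncVar κ x (b :: l) (x a) = trunc κ |x a - x b| + truncVar κ x l (x b) := by
  refine max_eq_right ?_
  change truncVar κ x l (x a) ≤ trunc κ |x a - x b| + truncVar κ x l (x b)
  match l, hz, h with
  | [], _, _ => exact add_nonneg (trunc_nonneg _ _) le_rfl
  | c :: l, hz, h =>
    -- If the differences decrease, all later values stay between `x a` and `x b`. If they increase,
    -- `x a` lies between `x b` and `x c`, and quasiconvexity of the value function bounds its value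
    -- at `x a`.
    rcases le_total |x b - x c| |x a - x b| with hd | hd
    · refine truncVar_le_of_near fun z hzm => ?_
      have := between_of_decreasing hz h hd z hzm
      rcases hz.1 with h1 | h1
      · rw [min_eq_right h1.1.le, max_eq_left h1.1.le] at this
        rw [abs_of_nonneg (by linarith), abs_of_pos (by linarith)]
        linarith
      · rw [min_eq_left h1.1.le, max_eq_right h1.1.le] at this
        rw [abs_of_nonpos (by linarith), abs_of_neg (by linarith)]
        linarith
    · have hf := isPlay_truncVar κ x l
      have h0 := trunc_nonneg κ |x a - x b|
      have h1 := le_visit κ (x c) (truncVar κ x l) (x b)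
      have h2 := step_le_visit κ (x c) (truncVar κ x l) (x b)
      have h3 := trunc_nonneg κ |x b - x c|
      have h4 : truncVar κ x l (x a) ≤ max (truncVar κ x l (x b)) (truncVar κ x l (x c)) ∧
          |x a - x c| ≤ |x b - x c| := by
        rcases hz.1 with h1 | h1
        · rw [abs_of_pos (by linarith), abs_of_neg (by linarith)] at hd
          rw [abs_of_nonpos (by linarith), abs_of_neg (by linarith)]
          exact ⟨hf.le_max_of_between h1.1.le (by linarith), by linarith⟩
        · rw [abs_of_neg (by linarith), abs_of_pos (by linarith)] at hd
          rw [abs_of_nonneg (by linarith), abs_of_pos (by linarith), max_comm]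
          exact ⟨hf.le_max_of_between (by linarith) h1.1.le, by linarith⟩
      rw [truncVar_cons]
      refine max_le (h4.1.trans (max_le (by linarith) (by linarith))) ?_
      linarith [trunc_mono κ h4.2]

theorem sum_steps_of_none {κ : ℝ} {x : ι → ℝ} {a : ι} {l : List ι}
    (hz : Zigzag x (a :: l)) (h : findFullCycle x (a :: l) = none) :
    (((a :: l).zip l).map fun e => trunc κ (depth x e)).sum = truncVar κ x l (x a) := by
  induction l generalizing a with
  | nil => rfl
  | cons b l ih =>
    have h' : findFullCycle x (b :: l) = none := by
      match l, h with
      | [], _ => rfl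
      | [_], _ => rfl
      | c :: d :: l, h =>
        rw [findFullCycle] at h
        split_ifs at h
        rwa [Option.map_eq_none_iff] at h
    rw [truncVar_cons_of_none hz h, ← ih hz.tail h', List.zip_cons_cons, List.map_cons,
      List.sum_cons, depth]

theorem sum_extractCycles {κ : ℝ} (hκ : 0 ≤ κ) {x : ι → ℝ} (n : ℕ) {a : ι} {l : List ι}
    (hn : (a :: l).length ≤ n) (hz : Zigzag x (a :: l)) :
    ((extractCycles x n (a :: l)).map fun e => trunc κ (depth x e)).sum
      = truncVar κ x l (x a) := by
  induction n generalizing l with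
  | zero => simp at hn
  | succ n ih =>
    rw [extractCycles]
    cases h : findFullCycle x (a :: l) with
    | none => exact sum_steps_of_none hz h
    | some p =>
      obtain ⟨e, l'⟩ := p
      obtain ⟨a', b, s, d, t, hl, rfl, hlen, -, -, hz', hW⟩ := findFullCycle_some hκ hz h
      simp only [List.cons.injEq] at hl
      obtain ⟨rfl, rfl⟩ := hl
      have h1 := hW (x a)
      rw [truncVar_cons, truncVar_cons κ x a, visit_self hκ, visit_self hκ] at h1
      simp only [List.map_cons, List.sum_cons]
      rw [ih (by simp at hlen hn ⊢; omega) hz', h1]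
      ring

/-- The Rainflow algorithm computes the truncated variations of a profile. -/
theorem sum_halfCycles {κ : ℝ} (hκ : 0 ≤ κ) (x : ι → ℝ) (a : ι) (l : List ι) :
    ((halfCycles x (a :: l)).map fun e => trunc κ (depth x e)).sum = truncVar κ x l (x a) := by
  obtain ⟨t, ht, -⟩ := exists_switchingTimes_eq_cons x a l
  have hz := zigzag_switchingTimes x (a :: l)
  have hW := congrFun (truncVar_switchingTimes hκ x (a :: l)) (x a)
  rw [ht, truncVar_cons, truncVar_cons, visit_self hκ, visit_self hκ] at hW
  rw [ht] at hz
  rw [halfCycles, ht, sum_extractCycles hκ _ le_rfl hz, hW]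

theorem length_findFullCycle {x : ι → ℝ} {l : List ι} {e : ι × ι} {l' : List ι}
    (h : findFullCycle x l = some (e, l')) : l.length = l'.length + 2 ∧ 2 ≤ l'.length := by
  match l, h with
  | a :: b :: c :: d :: l, h =>
    rw [findFullCycle] at h
    split_ifs at h
    · simp only [Option.some.injEq, Prod.mk.injEq] at h
      obtain ⟨rfl, rfl⟩ := h
      simp
    · rw [Option.map_eq_some_iff] at h
      obtain ⟨⟨e', m⟩, hm, he⟩ := h
      simp only [Prod.mk.injEq] at he
      obtain ⟨rfl, rfl⟩ := he
      have := length_findFullCycle hm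
      simp only [List.length_cons] at this ⊢
      omega

/-- Each extraction trades two nodes for two half-cycles. The bound `2 ≤ l'.length` keeps the
natural subtraction exact. -/
theorem length_extractCycles (x : ι → ℝ) (n : ℕ) (l : List ι) :
    (extractCycles x n l).length = l.length - 1 := by
  induction n generalizing l with
  | zero => simp [extractCycles]
  | succ n ih =>
    rw [extractCycles]
    cases h : findFullCycle x l with
    | none => simp
    | some p =>
      have := length_findFullCycle h
      simp only [List.length_cons, ih]
      omega

theorem length_halfCycles_le (x : ι → ℝ) (a : ι) (l : List ι) :
    (halfCycles x (a :: l)).length ≤ l.length := by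
  obtain ⟨t, ht, hl⟩ := exists_switchingTimes_eq_cons x a l
  rw [halfCycles, length_extractCycles, ht]
  simpa using hl

/-- The truncated variation is jointly convex in the threshold and the profile. -/
theorem truncVar_convex {s t : ℝ} (hs : 0 ≤ s) (ht : 0 ≤ t) (κ κ' : ℝ) (x x' : ι → ℝ)
    (l : List ι) (y y' : ℝ) :
    truncVar (s * κ + t * κ') (s • x + t • x') l (s * y + t * y')
      ≤ s * truncVar κ x l y + t * truncVar κ' x' l y' := by
  induction l generalizing y y' with
  | nil => simp [truncVar]
  | cons a l ih =>
    simp only [truncVar_cons]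
    refine max_le ((ih y y').trans ?_) ?_
    · gcongr <;> exact le_visit _ _ _ _
    -- Visiting the node: the step is `max (|Δ| - κ) 0`, sublinear in `(κ, Δ)`, so `s + t = 1` is
    -- not required.
    have h1 := ih (x a) (x' a)
    have h2 := mul_le_mul_of_nonneg_left (step_le_visit κ (x a) (truncVar κ x l) y) hs
    have h3 := mul_le_mul_of_nonneg_left (step_le_visit κ' (x' a) (truncVar κ' x' l) y') ht
    have h4 : trunc (s * κ + t * κ') |s * y + t * y' - (s • x + t • x') a|
        ≤ s * trunc κ |y - x a| + t * trunc κ' |y' - x' a| := by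
      have h5 : |s * y + t * y' - (s • x + t • x') a| ≤ s * |y - x a| + t * |y' - x' a| := by
        have := abs_add_le (s * (y - x a)) (t * (y' - x' a))
        rw [abs_mul, abs_mul, abs_of_nonneg hs, abs_of_nonneg ht] at this
        refine le_trans (le_of_eq ?_) this
        simp only [Pi.add_apply, Pi.smul_apply, smul_eq_mul]
        ring_nf
      refine max_le ?_ (add_nonneg (mul_nonneg hs (trunc_nonneg _ _))
        (mul_nonneg ht (trunc_nonneg _ _)))
      have h6 := mul_le_mul_of_nonneg_left (sub_le_trunc κ |y - x a|) hs
      have h7 := mul_le_mul_of_nonneg_left (sub_le_trunc κ' |y' - x' a|) ht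
      linarith
    have h5 : (s • x + t • x') a = s * x a + t * x' a := rfl
    rw [h5] at h4 ⊢
    linarith

end RainflowVariation

section SortedDepths

/-! ### Sorted cycle depths -/

theorem finRange_eq_zero_cons (T : ℕ) :
    List.finRange (T + 1) = 0 :: (List.finRange T).map Fin.succ := List.finRange_succ

variable {T : ℕ}

/-- At most `T` half-cycles are counted, so `T - l.length` is not cut off at zero and `getD` never
returns its default. -/
theorem length_edges (x : Fin (T + 1) → ℝ) : (edges x).length = T := by
  have h := length_halfCycles_le x 0 ((List.finRange T).map Fin.succ)
  rw [← finRange_eq_zero_cons] at h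
  simp only [List.length_map, List.length_finRange] at h
  simp only [edges, List.length_insertionSort, List.length_append, List.length_replicate,
    List.length_map]
  omega

theorem edges_oriented (x : Fin (T + 1) → ℝ) : ∀ e ∈ edges x, x e.2 ≤ x e.1 := by
  intro e he
  simp only [edges, List.mem_insertionSort, List.mem_append, List.mem_replicate,
    List.mem_map] at he
  rcases he with ⟨-, rfl⟩ | ⟨e', -, rfl⟩
  · exact le_rfl
  · rw [orient]
    split_ifs with h
    · exact h
    · exact (not_le.1 h).le

/-- The depths of the half-cycles, in nondecreasing order. -/
def sortedDepths (x : Fin (T + 1) → ℝ) (k : Fin T) : ℝ := depth x ((edges x).getD k (0, 0))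

theorem incidence_transpose_mulVec (x y : Fin (T + 1) → ℝ) (k : Fin T) :
    ((incidence x)ᵀ *ᵥ y) k
      = y ((edges x).getD k (0, 0)).1 - y ((edges x).getD k (0, 0)).2 := by
  simp [Matrix.mulVec, dotProduct, incidence, sub_mul, Finset.sum_sub_distrib, Pi.single_apply]

theorem incidence_transpose_mulVec_self (x : Fin (T + 1) → ℝ) :
    (incidence x)ᵀ *ᵥ x = sortedDepths x := by
  funext k
  have hk : (k : ℕ) < (edges x).length := by rw [length_edges]; exact k.2
  rw [incidence_transpose_mulVec, sortedDepths, depth, List.getD_eq_getElem _ _ hk,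
    abs_of_nonneg (sub_nonneg.2 (edges_oriented x _ (List.getElem_mem hk)))]

theorem diffMatrix_mulVec (x : Fin (T + 1) → ℝ) (t : Fin T) :
    (diffMatrix T *ᵥ x) t = x t.succ - x t.castSucc := by
  have hne : t.succ ≠ t.castSucc := by simp [Fin.ext_iff]
  have h : ∀ k, diffMatrix T t k * x k
      = (if k = t.succ then x k else 0) - (if k = t.castSucc then x k else 0) := by
    intro k
    by_cases hk : k = t.succ
    · subst hk; simp [diffMatrix, hne]
    · by_cases hk' : k = t.castSucc
      · subst hk'; simp [diffMatrix, hne.symm]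
      · simp [diffMatrix, hk, hk']
  simp [Matrix.mulVec, dotProduct, h, Finset.sum_sub_distrib]

theorem eq_of_diffMatrix_mulVec_eq_zero {x : Fin (T + 1) → ℝ} (h : diffMatrix T *ᵥ x = 0)
    (k : Fin (T + 1)) : x k = x 0 := by
  induction k using Fin.induction with
  | zero => rfl
  | succ i ih =>
    have := congrFun h i
    rw [diffMatrix_mulVec, Pi.zero_apply] at this
    linarith

/-- Since `A x = -(1/E) u`, the product is `M(x)ᵀ A† A x`. The vectors `A† A x` and `x` differ by a
constant, which the columns of `M(x)` annihilate. -/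
theorem rateMatrix_mulVec (E x₀ : ℝ) (u : Fin T → ℝ) :
    rateMatrix E x₀ u *ᵥ u = sortedDepths (soc E x₀ u) := by
  set x := soc E x₀ u with hx
  have h1 : rateMatrix E x₀ u *ᵥ u = (incidence x)ᵀ *ᵥ (diffPinv T *ᵥ (diffMatrix T *ᵥ x)) := by
    rw [hx, diffMatrix_mulVec_soc, rateMatrix, Matrix.smul_mulVec, Matrix.mulVec_smul,
      Matrix.mulVec_smul, Matrix.mulVec_mulVec]
  have h2 : diffMatrix T *ᵥ (diffPinv T *ᵥ (diffMatrix T *ᵥ x) - x) = 0 := by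
    rw [Matrix.mulVec_sub, Matrix.mulVec_mulVec, diffMatrix_mul_diffPinv, Matrix.one_mulVec,
      sub_self]
  rw [h1, ← incidence_transpose_mulVec_self, ← sub_eq_zero, ← Matrix.mulVec_sub]
  funext k
  rw [incidence_transpose_mulVec, eq_of_diffMatrix_mulVec_eq_zero h2,
    eq_of_diffMatrix_mulVec_eq_zero h2 (Prod.snd _), sub_self, Pi.zero_apply]

theorem sortedDepths_nonneg (x : Fin (T + 1) → ℝ) (k : Fin T) : 0 ≤ sortedDepths x k :=
  abs_nonneg _

theorem sortedDepths_mono (x : Fin (T + 1) → ℝ) : Monotone (sortedDepths x) := by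
  intro j k hjk
  have hk : (k : ℕ) < (edges x).length := by rw [length_edges]; exact k.2
  have hj : (j : ℕ) < (edges x).length := by rw [length_edges]; exact j.2
  rcases hjk.eq_or_lt with rfl | h
  · exact le_rfl
  rw [sortedDepths, sortedDepths, List.getD_eq_getElem _ _ hk, List.getD_eq_getElem _ _ hj]
  let r : Fin (T + 1) × Fin (T + 1) → Fin (T + 1) × Fin (T + 1) → Prop :=
    fun e f => depth x e ≤ depth x f
  have : Std.Total r := ⟨fun e f => le_total (depth x e) (depth x f)⟩
  have : IsTrans _ r := ⟨fun e f g => le_trans (a := depth x e)⟩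
  have hp : (edges x).Pairwise r := List.pairwise_insertionSort _ _
  exact List.pairwise_iff_getElem.1 hp _ _ hj hk h

theorem depth_orient {ι : Type*} (x : ι → ℝ) (e : ι × ι) : depth x (orient x e) = depth x e := by
  rw [orient]
  split_ifs
  · rfl
  · exact abs_sub_comm _ _

/-- The part of the sorted depths above a threshold is a truncated variation. -/
theorem sum_trunc_sortedDepths {κ : ℝ} (hκ : 0 ≤ κ) (x : Fin (T + 1) → ℝ) :
    ∑ k, trunc κ (sortedDepths x k) = truncVar κ x ((List.finRange T).map Fin.succ) (x 0) := by
  have h1 : List.ofFn (fun k => trunc κ (sortedDepths x k))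
      = (edges x).map fun e => trunc κ (depth x e) := by
    refine List.ext_getElem (by simp [length_edges]) fun i h h' => ?_
    have hi : i < (edges x).length := by simpa using h'
    simp [sortedDepths, hi]
  rw [← List.sum_ofFn, h1, edges, ((List.perm_insertionSort _ _).map _).sum_eq,
    ← sum_halfCycles hκ, ← finRange_eq_zero_cons]
  have hd : depth x ((0, 0) : Fin (T + 1) × Fin (T + 1)) = 0 := by simp [depth]
  simp [Function.comp_def, depth_orient, hd, trunc_zero hκ]

/-! ### Convexity of weighted sums of the sorted depths -/

/-- Together with `sum_tail_eq`: for sorted `v` a tail sum is the minimum over `κ` of the right-hand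
side, attained at `κ = v j`. -/
theorem sum_tail_le (κ : ℝ) (v : Fin T → ℝ) (j : Fin T) :
    ∑ k, (if j ≤ k then v k else 0)
      ≤ ∑ k, trunc κ (v k) + κ * ∑ k : Fin T, if j ≤ k then 1 else 0 := by
  rw [Finset.mul_sum, ← Finset.sum_add_distrib]
  refine Finset.sum_le_sum fun k _ => ?_
  split_ifs
  · linarith [sub_le_trunc κ (v k)]
  · linarith [trunc_nonneg κ (v k)]

theorem sum_tail_eq {v : Fin T → ℝ} (hv : Monotone v) (j : Fin T) :
    ∑ k, (if j ≤ k then v k else 0)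
      = ∑ k, trunc (v j) (v k) + v j * ∑ k : Fin T, if j ≤ k then 1 else 0 := by
  rw [Finset.mul_sum, ← Finset.sum_add_distrib]
  refine Finset.sum_congr rfl fun k _ => ?_
  split_ifs with h
  · rw [trunc, max_eq_left (by linarith [hv h])]
    ring
  · rw [trunc, max_eq_right (by linarith [hv (le_of_not_ge h)])]
    ring

/-- Partial minimization of a jointly convex function is convex: the optimal thresholds of `x` and
`y` are combined with the same `s`, `t`. -/
theorem sum_tail_convex {s t : ℝ} (hs : 0 ≤ s) (ht : 0 ≤ t) (x y : Fin (T + 1) → ℝ) (j : Fin T) :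
    ∑ k, (if j ≤ k then sortedDepths (s • x + t • y) k else 0)
      ≤ s * ∑ k, (if j ≤ k then sortedDepths x k else 0)
        + t * ∑ k, (if j ≤ k then sortedDepths y k else 0) := by
  have hx := sortedDepths_nonneg x j
  have hy := sortedDepths_nonneg y j
  have hκ : 0 ≤ s * sortedDepths x j + t * sortedDepths y j := by positivity
  refine (sum_tail_le (s * sortedDepths x j + t * sortedDepths y j) _ j).trans ?_
  rw [sum_tail_eq (sortedDepths_mono x), sum_tail_eq (sortedDepths_mono y),
    sum_trunc_sortedDepths hκ, sum_trunc_sortedDepths hx, sum_trunc_sortedDepths hy]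
  have := truncVar_convex hs ht (sortedDepths x j) (sortedDepths y j) x y
    ((List.finRange T).map Fin.succ) (x 0) (y 0)
  have e : (s • x + t • y) 0 = s * x 0 + t * y 0 := rfl
  rw [e]
  linarith

/-- Abel summation: `w` consists of `θ 0` and the successive increments of `θ`. -/
theorem exists_increments {T : ℕ} (θ : Fin T → ℝ) (hm : Monotone θ) (h0 : ∀ k, 0 ≤ θ k) :
    ∃ w : Fin T → ℝ, (∀ j, 0 ≤ w j) ∧ ∀ k, θ k = ∑ j, if j ≤ k then w j else 0 := by
  induction T with
  | zero => exact ⟨θ, h0, fun k => k.elim0⟩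
  | succ T ih =>
    obtain ⟨w, hw, h⟩ := ih (fun k => θ k.succ - θ 0)
      (fun j k hjk => sub_le_sub_right (hm (Fin.succ_le_succ_iff.2 hjk)) _)
      (fun k => sub_nonneg.2 (hm (Fin.zero_le _)))
    refine ⟨Fin.cons (θ 0) w, fun j => ?_, fun k => ?_⟩
    · induction j using Fin.cases with
      | zero => exact h0 0
      | succ j => exact hw j
    · induction k using Fin.cases with
      | zero => simp
      | succ k =>
        have := h k
        simp only [Fin.sum_univ_succ, Fin.cons_zero, Fin.cons_succ, Fin.zero_le, if_true,
          Fin.succ_le_succ_iff]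
        linarith

/-- Weighted sums of the sorted depths are convex functions of the profile, if larger depths have
larger weights. -/
theorem convexOn_dotProduct_sortedDepths {θ : Fin T → ℝ} (hm : Monotone θ) (h0 : ∀ k, 0 ≤ θ k) :
    ConvexOn ℝ Set.univ fun x => θ ⬝ᵥ sortedDepths x := by
  obtain ⟨w, hw, h⟩ := exists_increments θ hm h0
  have e : ∀ x : Fin (T + 1) → ℝ, θ ⬝ᵥ sortedDepths x
      = ∑ j, w j * ∑ k, (if j ≤ k then sortedDepths x k else 0) := by
    intro x
    simp only [dotProduct, h, Finset.sum_mul, Finset.mul_sum]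
    rw [Finset.sum_comm]
    refine Finset.sum_congr rfl fun j _ => Finset.sum_congr rfl fun k _ => ?_
    split_ifs <;> simp
  refine ⟨convex_univ, fun x _ y _ s t hs ht _ => ?_⟩
  simp only [e, smul_eq_mul]
  rw [Finset.mul_sum (a := s), Finset.mul_sum (a := t), ← Finset.sum_add_distrib]
  refine Finset.sum_le_sum fun j _ => ?_
  have := mul_le_mul_of_nonneg_left (sum_tail_convex hs ht x y j) (hw j)
  linarith

/-- A single sorted depth need not be convex, but it is the difference of two tail sums, which are
convex on a finite-dimensional space and hence continuous. -/
theorem continuous_sortedDepths : Continuous (sortedDepths (T := T)) := by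
  refine continuous_pi fun k => ?_
  have hc : ∀ θ : Fin T → ℝ, Monotone θ → (∀ k, 0 ≤ θ k) →
      Continuous fun x => θ ⬝ᵥ sortedDepths x := fun θ hm h0 =>
    (convexOn_dotProduct_sortedDepths hm h0).locallyLipschitz.continuous
  have h1 := hc (fun j => if k ≤ j then 1 else 0)
    (fun i j hij => by
      dsimp only
      split_ifs with h h' <;> first | exact le_rfl | exact zero_le_one | exact absurd (h.trans hij) h')
    (fun j => by split_ifs <;> norm_num)
  have h2 := hc (fun j => if k < j then 1 else 0)
    (fun i j hij => by
      dsimp only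
      split_ifs with h h' <;>
        first | exact le_rfl | exact zero_le_one | exact absurd (h.trans_le hij) h')
    (fun j => by split_ifs <;> norm_num)
  convert h1.sub h2 using 1
  funext x
  rw [Pi.sub_apply, ← sub_dotProduct]
  have : (fun j => if k ≤ j then (1 : ℝ) else 0) - (fun j => if k < j then (1 : ℝ) else 0)
      = Pi.single k 1 := by
    funext j
    rcases lt_trichotomy j k with h | rfl | h
    · simp [h.not_ge, h.not_gt, h.ne]
    · simp
    · simp [h.le, h, h.ne']
  rw [this, single_dotProduct, one_mul]

theorem dotProduct_self_convex {ι : Type*} [Fintype ι] {s t : ℝ} (hs : 0 ≤ s) (ht : 0 ≤ t)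
    (hst : s + t = 1) (v w : ι → ℝ) :
    (s • v + t • w) ⬝ᵥ (s • v + t • w) ≤ s * (v ⬝ᵥ v) + t * (w ⬝ᵥ w) := by
  simp only [dotProduct, Finset.mul_sum, ← Finset.sum_add_distrib]
  refine Finset.sum_le_sum fun k _ => ?_
  simp only [Pi.add_apply, Pi.smul_apply, smul_eq_mul]
  obtain rfl : t = 1 - s := by linarith
  nlinarith [mul_nonneg (mul_nonneg hs ht) (sq_nonneg (v k - w k))]

theorem two_mul_dotProduct_le {ι : Type*} [Fintype ι] (v w : ι → ℝ) :
    2 * (v ⬝ᵥ w) ≤ v ⬝ᵥ v + w ⬝ᵥ w := by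
  simp only [dotProduct, Finset.mul_sum, ← Finset.sum_add_distrib]
  exact Finset.sum_le_sum fun k _ => by nlinarith [sq_nonneg (v k - w k)]

/-- The sum of the squared depths is a convex function of the profile. -/
theorem sortedDepths_sq_convex {s t : ℝ} (hs : 0 ≤ s) (ht : 0 ≤ t) (hst : s + t = 1)
    (x y : Fin (T + 1) → ℝ) :
    sortedDepths (s • x + t • y) ⬝ᵥ sortedDepths (s • x + t • y)
      ≤ s * (sortedDepths x ⬝ᵥ sortedDepths x) + t * (sortedDepths y ⬝ᵥ sortedDepths y) := by
  -- The weights are frozen at the depths of the combined profile, which are sorted and nonnegative;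
  -- then `2 θ·v ≤ θ·θ + v·v` finishes.
  set θ := sortedDepths (s • x + t • y)
  have h := (convexOn_dotProduct_sortedDepths (sortedDepths_mono (s • x + t • y))
    (sortedDepths_nonneg _)).2 (Set.mem_univ x) (Set.mem_univ y) hs ht hst
  have h1 := mul_le_mul_of_nonneg_left (two_mul_dotProduct_le θ (sortedDepths x)) hs
  have h2 := mul_le_mul_of_nonneg_left (two_mul_dotProduct_le θ (sortedDepths y)) ht
  simp only [smul_eq_mul] at h
  change θ ⬝ᵥ θ ≤ _ at h
  have h3 : s * (θ ⬝ᵥ θ) + t * (θ ⬝ᵥ θ) = θ ⬝ᵥ θ := by rw [← add_mul, hst, one_mul]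
  linarith

end SortedDepths

/-! ### The cycle depths as functions of the rates -/

section Rates

variable {T : ℕ}

theorem soc_combo (E x₀ : ℝ) {s t : ℝ} (hst : s + t = 1) (u v : Fin T → ℝ) :
    soc E x₀ (s • u + t • v) = s • soc E x₀ u + t • soc E x₀ v := by
  funext k
  simp only [soc, Pi.add_apply, Pi.smul_apply, smul_eq_mul, Finset.sum_add_distrib,
    ← Finset.mul_sum]
  linear_combination -x₀ * hst

theorem continuous_soc (E x₀ : ℝ) : Continuous (soc (T := T) E x₀) := by
  unfold soc
  fun_prop

theorem convexOn_dotProduct_rateMatrix (E x₀ : ℝ) {θ : Fin T → ℝ} (hm : Monotone θ)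
    (h0 : ∀ k, 0 ≤ θ k) : ConvexOn ℝ Set.univ fun v => θ ⬝ᵥ (rateMatrix E x₀ v *ᵥ v) := by
  refine ⟨convex_univ, fun u _ v _ s t hs ht hst => ?_⟩
  simp only [rateMatrix_mulVec, soc_combo E x₀ hst]
  exact (convexOn_dotProduct_sortedDepths hm h0).2 (Set.mem_univ _) (Set.mem_univ _) hs ht hst

/-- An affine minorant of a convex function that is exact on an open set. -/
theorem linear_le_of_eventuallyEq {F : Type*} [NormedAddCommGroup F] [NormedSpace ℝ F]
    {h : F → ℝ} (hc : ConvexOn ℝ Set.univ h) (ℓ : F →ₗ[ℝ] ℝ) {v : F}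
    (hv : ∀ᶠ y in 𝓝 v, h y = ℓ y) (y : F) : ℓ y ≤ h y := by
  have hconv : ConvexOn ℝ Set.univ fun y => h y - ℓ y := hc.sub (ℓ.concaveOn convex_univ)
  have hloc : IsLocalMin (fun y => h y - ℓ y) v := by
    filter_upwards [hv] with z hz
    rw [hz, hv.self_of_nhds, sub_self, sub_self]
  have := IsMinOn.of_isLocalMin_of_convex_univ hloc hconv y
  simp only [hv.self_of_nhds, sub_self] at this
  linarith

/-- Where `N` equals `B`, the convex function `θ ⬝ᵥ N(v)v` is linear with gradient `Bᵀ θ`, so this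
linear function is a global minorant; equality reaches `u` in the closure by continuity. -/
theorem associatedMatrices_subgradient (E x₀ : ℝ) {θ : Fin T → ℝ} (hm : Monotone θ)
    (h0 : ∀ k, 0 ≤ θ k) {u : Fin T → ℝ} {B : Matrix (Fin T) (Fin T) ℝ}
    (hB : B ∈ associatedMatrices E x₀ u) :
    (∀ v, (Bᵀ *ᵥ θ) ⬝ᵥ v ≤ θ ⬝ᵥ (rateMatrix E x₀ v *ᵥ v)) ∧
      (Bᵀ *ᵥ θ) ⬝ᵥ u = θ ⬝ᵥ (rateMatrix E x₀ u *ᵥ u) := by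
  have hc := convexOn_dotProduct_rateMatrix E x₀ hm h0
  have key : ∀ v, (Bᵀ *ᵥ θ) ⬝ᵥ v = θ ⬝ᵥ (B *ᵥ v) := fun v => by
    rw [Matrix.mulVec_transpose, Matrix.dotProduct_mulVec]
  have heq : ∀ v ∈ interior {v | rateMatrix E x₀ v = B},
      (Bᵀ *ᵥ θ) ⬝ᵥ v = θ ⬝ᵥ (rateMatrix E x₀ v *ᵥ v) := fun v hv => by
    rw [key, interior_subset (s := {v | rateMatrix E x₀ v = B}) hv]
  change u ∈ closure (interior {v | rateMatrix E x₀ v = B}) at hB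
  constructor
  · obtain ⟨v, hv⟩ := closure_nonempty_iff.1 ⟨u, hB⟩
    refine linear_le_of_eventuallyEq hc (dotProductBilin ℝ ℝ (Bᵀ *ᵥ θ)) (v := v) ?_
    filter_upwards [isOpen_interior.mem_nhds hv] with y hy
    exact (heq y hy).symm
  · have hcont : Continuous fun v => θ ⬝ᵥ (rateMatrix E x₀ v *ᵥ v) :=
      hc.locallyLipschitz.continuous
    have hcont' : Continuous fun v => (Bᵀ *ᵥ θ) ⬝ᵥ v := by
      simp only [dotProduct]
      fun_prop
    have hcl : IsClosed {v | (Bᵀ *ᵥ θ) ⬝ᵥ v = θ ⬝ᵥ (rateMatrix E x₀ v *ᵥ v)} :=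
      isClosed_eq hcont' hcont
    exact hcl.closure_subset_iff.2 heq hB

theorem convexHull_subgradient (E x₀ : ℝ) {θ : Fin T → ℝ} (hm : Monotone θ)
    (h0 : ∀ k, 0 ≤ θ k) {u w : Fin T → ℝ}
    (hw : w ∈ convexHull ℝ ((fun B : Matrix (Fin T) (Fin T) ℝ => Bᵀ *ᵥ θ) ''
      associatedMatrices E x₀ u)) :
    (∀ v, w ⬝ᵥ v ≤ θ ⬝ᵥ (rateMatrix E x₀ v *ᵥ v)) ∧
      w ⬝ᵥ u = θ ⬝ᵥ (rateMatrix E x₀ u *ᵥ u) := by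
  let P : Set (Fin T → ℝ) := {w | (∀ v, w ⬝ᵥ v ≤ θ ⬝ᵥ (rateMatrix E x₀ v *ᵥ v)) ∧
      w ⬝ᵥ u = θ ⬝ᵥ (rateMatrix E x₀ u *ᵥ u)}
  have hP : Convex ℝ P := by
    intro p hp q hq s t hs ht hst
    have e : ∀ v, (s • p + t • q) ⬝ᵥ v = s * (p ⬝ᵥ v) + t * (q ⬝ᵥ v) := fun v => by
      simp [add_dotProduct, smul_dotProduct]
    refine ⟨fun v => ?_, ?_⟩
    · have h1 := mul_le_mul_of_nonneg_left (hp.1 v) hs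
      have h2 := mul_le_mul_of_nonneg_left (hq.1 v) ht
      rw [e]
      refine (add_le_add h1 h2).trans (le_of_eq ?_)
      rw [← add_mul, hst, one_mul]
    · rw [e, hp.2, hq.2, ← add_mul, hst, one_mul]
  refine convexHull_min (t := P) ?_ hP hw
  rintro _ ⟨B, hB, rfl⟩
  exact associatedMatrices_subgradient E x₀ hm h0 hB

end Rates

namespace Data

variable {G S : Type*} [Fintype G] [Fintype S] {T : ℕ} (D : Data G S T)

/-! ### Local minimizers -/

/-- The point with generation `p.1` and storage rates `p.2` that satisfies the Rainflow
constraint. -/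
def lift (p : (G → Fin T → ℝ) × (S → Fin T → ℝ)) : Point G S T :=
  (p.1, p.2, fun i => D.cycleDepths i (p.2 i))

theorem cycleDepths_eq {G S : Type*} {T : ℕ} (D : Data G S T) (i : S) (v : Fin T → ℝ) :
    D.cycleDepths i v = sortedDepths (soc (D.E i) (D.x₀ i) v) := rateMatrix_mulVec _ _ _

theorem continuous_lift {G S : Type*} {T : ℕ} (D : Data G S T) : Continuous D.lift := by
  have h : ∀ i, Continuous (D.cycleDepths i) := fun i => by
    simp only [funext (D.cycleDepths_eq i)]
    exact continuous_sortedDepths.comp (continuous_soc _ _)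
  refine continuous_fst.prodMk (continuous_snd.prodMk (continuous_pi fun i => ?_))
  exact (h i).comp ((continuous_apply i).comp continuous_snd)

theorem lift_eq_of_isFeasible {z : Point G S T} (hz : D.IsFeasible z) :
    D.lift (z.1, z.2.1) = z := by
  refine Prod.ext rfl (Prod.ext rfl ?_)
  exact (funext hz.rainflow).symm

theorem combo_mem_Icc {a b p q s t : ℝ} (hs : 0 ≤ s) (ht : 0 ≤ t) (hst : s + t = 1)
    (hp : a ≤ p ∧ p ≤ b) (hq : a ≤ q ∧ q ≤ b) : a ≤ s * p + t * q ∧ s * p + t * q ≤ b :=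
  convex_Icc a b hp hq hs ht hst

/-- Once `ν` is eliminated, the Rainflow constraint holds by definition and only linear constraints
remain. -/
theorem convex_lift_preimage : Convex ℝ (D.lift ⁻¹' D.feasibleSet) := by
  intro p hp q hq s t hs ht hst
  change D.IsFeasible _ at hp hq
  refine ⟨fun i => rfl, fun j k => ?_, fun i k => ?_, fun i => ?_, fun i k => ?_, ?_⟩
  · exact combo_mem_Icc hs ht hst (hp.gen_limit j k) (hq.gen_limit j k)
  · exact combo_mem_Icc hs ht hst (hp.rate_limit i k) (hq.rate_limit i k)
  · have h1 := hp.periodic i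
    have h2 := hq.periodic i
    change ∑ k, (s * p.2 i k + t * q.2 i k) = 0
    change ∑ k, p.2 i k = 0 at h1
    change ∑ k, q.2 i k = 0 at h2
    rw [Finset.sum_add_distrib, ← Finset.mul_sum, ← Finset.mul_sum, h1, h2]
    ring
  · have e : (cumMatrix T (D.E i) *ᵥ (s • p.2 i + t • q.2 i)) k
        = s * (cumMatrix T (D.E i) *ᵥ p.2 i) k + t * (cumMatrix T (D.E i) *ᵥ q.2 i) k := by
      simp [Matrix.mulVec_add, Matrix.mulVec_smul]
    change _ ≤ (cumMatrix T (D.E i) *ᵥ (s • p.2 i + t • q.2 i)) k ∧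
      (cumMatrix T (D.E i) *ᵥ (s • p.2 i + t • q.2 i)) k ≤ _
    rw [e]
    exact combo_mem_Icc hs ht hst (hp.soc_limit i k) (hq.soc_limit i k)
  · have h1 : D.d = ∑ j, p.1 j + ∑ i, p.2 i := hp.balance
    have h2 : D.d = ∑ j, q.1 j + ∑ i, q.2 i := hq.balance
    change D.d = ∑ j, (s • p.1 j + t • q.1 j) + ∑ i, (s • p.2 i + t • q.2 i)
    rw [Finset.sum_add_distrib, Finset.sum_add_distrib, ← Finset.smul_sum, ← Finset.smul_sum,
      ← Finset.smul_sum, ← Finset.smul_sum]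
    calc D.d = s • D.d + t • D.d := by rw [← add_smul, hst, one_smul]
      _ = s • (∑ j, p.1 j + ∑ i, p.2 i) + t • (∑ j, q.1 j + ∑ i, q.2 i) := by rw [← h1, ← h2]
      _ = _ := by rw [smul_add, smul_add]; abel

theorem convexOn_cost_lift : ConvexOn ℝ (D.lift ⁻¹' D.feasibleSet) (D.cost ∘ D.lift) := by
  refine ⟨D.convex_lift_preimage, fun p _ q _ s t hs ht hst => ?_⟩
  simp only [Function.comp_apply, cost, smul_eq_mul, mul_add, Finset.mul_sum]
  rw [add_add_add_comm, ← Finset.sum_add_distrib, ← Finset.sum_add_distrib]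
  refine add_le_add (Finset.sum_le_sum fun i _ => ?_) (Finset.sum_le_sum fun j _ => ?_)
  · have h := sortedDepths_sq_convex hs ht hst (soc (D.E i) (D.x₀ i) (p.2 i))
      (soc (D.E i) (D.x₀ i) (q.2 i))
    rw [← soc_combo _ _ hst, ← cycleDepths_eq, ← cycleDepths_eq, ← cycleDepths_eq] at h
    have hβ : 0 ≤ 1 / (2 * D.β i) := by have := D.β_pos i; positivity
    have h' := mul_le_mul_of_nonneg_left h hβ
    refine h'.trans (le_of_eq ?_)
    simp only [lift]
    ring
  · have h := dotProduct_self_convex hs ht hst (p.1 j) (q.1 j)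
    have hα : 0 ≤ 1 / (2 * D.α j) := by have := D.α_pos j; positivity
    have h' := mul_le_mul_of_nonneg_left h hα
    refine h'.trans (le_of_eq ?_)
    simp only [lift]
    ring

theorem IsLocalSolution.isGlobalSolution {D : Data G S T} {z : Point G S T}
    (hz : D.IsLocalSolution z) : D.IsGlobalSolution z := by
  obtain ⟨hf, hl⟩ := hz
  refine ⟨hf, ?_⟩
  have ez := D.lift_eq_of_isFeasible hf
  have hloc : IsLocalMinOn (D.cost ∘ D.lift) (D.lift ⁻¹' D.feasibleSet) (z.1, z.2.1) := by
    -- Continuity of `D.lift` carries nearby reduced points to feasible points near `z`.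
    have ht : Filter.Tendsto D.lift (𝓝[D.lift ⁻¹' D.feasibleSet] (z.1, z.2.1))
        (𝓝[D.feasibleSet] z) := by
      have h := D.continuous_lift.continuousWithinAt.tendsto_nhdsWithin
        (s := D.lift ⁻¹' D.feasibleSet) (x := (z.1, z.2.1)) (t := D.feasibleSet)
        (fun _ h => h)
      rwa [ez] at h
    have := ht.eventually hl
    filter_upwards [this] with p hp
    simpa only [Function.comp_apply, ez] using hp
  have hmin := IsMinOn.of_isLocalMinOn_of_convexOn
    (by rwa [Set.mem_preimage, ez]) hloc D.convexOn_cost_lift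
  intro z' hz'
  have e' := D.lift_eq_of_isFeasible hz'
  have h := hmin (show (z'.1, z'.2.1) ∈ D.lift ⁻¹' D.feasibleSet by rwa [Set.mem_preimage, e'])
  simpa only [Set.mem_ofPred_eq, Function.comp_apply, ez, e'] using h

/-! ### Minimization of the Lagrangian -/

/-- The Lagrangian as a constant and separate contributions of the units. -/
theorem lagrangian_eq (z : Point G S T) (m : Multipliers G S T) :
    D.lagrangian z m = m.lam ⬝ᵥ D.d
      + ∑ j, (1 / (2 * D.α j) * (z.1 j ⬝ᵥ z.1 j) - (m.lam - m.ηHi j + m.ηLo j) ⬝ᵥ z.1 j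
          + (m.ηLo j ⬝ᵥ (fun _ => D.gLo j) - m.ηHi j ⬝ᵥ fun _ => D.gHi j))
      + ∑ i, ((1 / (2 * D.β i) * (z.2.2 i ⬝ᵥ z.2.2 i) - m.θ i ⬝ᵥ z.2.2 i)
          + (m.θ i ⬝ᵥ D.cycleDepths i (z.2.1 i) - (m.lam - (fun _ => m.δ i)
              - (cumMatrix T (D.E i))ᵀ *ᵥ (m.μHi i - m.μLo i) - m.κHi i + m.κLo i) ⬝ᵥ z.2.1 i)
          + (m.μLo i ⬝ᵥ (fun _ => D.x₀ i - 1) - m.μHi i ⬝ᵥ (fun _ => D.x₀ i)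
              + m.κLo i ⬝ᵥ (fun _ => D.uLo i) - m.κHi i ⬝ᵥ fun _ => D.uHi i)) := by
  have hsub : ∀ (p : Fin T → ℝ) (q r : Fin T → ℝ),
      p ⬝ᵥ (fun t => q t - r t) = p ⬝ᵥ q - p ⬝ᵥ r := fun p q r => dotProduct_sub p q r
  have hδ : ∀ (c : ℝ) (v : Fin T → ℝ), (fun _ => c) ⬝ᵥ v = c * ∑ t, v t := fun c v => by
    simp [dotProduct, Finset.mul_sum]
  have hA : ∀ i (p : Fin T → ℝ), ((cumMatrix T (D.E i))ᵀ *ᵥ p) ⬝ᵥ z.2.1 i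
      = p ⬝ᵥ (cumMatrix T (D.E i) *ᵥ z.2.1 i) := fun i p => by
    rw [Matrix.mulVec_transpose, Matrix.dotProduct_mulVec]
  have hμ : ∀ i, m.μLo i ⬝ᵥ (fun t => D.x₀ i - 1 - (cumMatrix T (D.E i) *ᵥ z.2.1 i) t)
      = m.μLo i ⬝ᵥ (fun _ => D.x₀ i - 1) - m.μLo i ⬝ᵥ (cumMatrix T (D.E i) *ᵥ z.2.1 i) :=
    fun i => hsub _ _ _
  have hμ' : ∀ i, m.μHi i ⬝ᵥ (fun t => (cumMatrix T (D.E i) *ᵥ z.2.1 i) t - D.x₀ i)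
      = m.μHi i ⬝ᵥ (cumMatrix T (D.E i) *ᵥ z.2.1 i) - m.μHi i ⬝ᵥ (fun _ => D.x₀ i) :=
    fun i => hsub _ _ _
  have hη : ∀ j, m.ηLo j ⬝ᵥ (fun t => D.gLo j - z.1 j t)
      = m.ηLo j ⬝ᵥ (fun _ => D.gLo j) - m.ηLo j ⬝ᵥ z.1 j := fun j => hsub _ _ _
  have hη' : ∀ j, m.ηHi j ⬝ᵥ (fun t => z.1 j t - D.gHi j)
      = m.ηHi j ⬝ᵥ z.1 j - m.ηHi j ⬝ᵥ (fun _ => D.gHi j) := fun j => hsub _ _ _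
  have hκ : ∀ i, m.κLo i ⬝ᵥ (fun t => D.uLo i - z.2.1 i t)
      = m.κLo i ⬝ᵥ (fun _ => D.uLo i) - m.κLo i ⬝ᵥ z.2.1 i := fun i => hsub _ _ _
  have hκ' : ∀ i, m.κHi i ⬝ᵥ (fun t => z.2.1 i t - D.uHi i)
      = m.κHi i ⬝ᵥ z.2.1 i - m.κHi i ⬝ᵥ (fun _ => D.uHi i) := fun i => hsub _ _ _
  simp only [lagrangian, cost, hμ, hμ', hη, hη', hκ, hκ', dotProduct_sub, sub_dotProduct,
    add_dotProduct, dotProduct_sum, hδ, hA, Finset.sum_add_distrib, Finset.sum_sub_distrib]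
  ring

/-- The difference of the two sides is `1 / (2a)` times the squared distance of `v` and `w`. -/
theorem quadratic_min {ι : Type*} [Fintype ι] {a : ℝ} (ha : 0 < a) {p v : ι → ℝ}
    (hp : p = (1 / a) • v) (w : ι → ℝ) :
    1 / (2 * a) * (v ⬝ᵥ v) - p ⬝ᵥ v ≤ 1 / (2 * a) * (w ⬝ᵥ w) - p ⬝ᵥ w := by
  have h := mul_le_mul_of_nonneg_left (two_mul_dotProduct_le v w)
    (show 0 ≤ 1 / (2 * a) by positivity)
  rw [hp, smul_dotProduct, smul_dotProduct, smul_eq_mul, smul_eq_mul]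
  have e : 1 / a = 1 / (2 * a) * 2 := by field_simp
  rw [e]
  linarith

theorem IsLocallyOptimal.isGloballyOptimal {D : Data G S T} {z : Point G S T}
    {m : Multipliers G S T} (h : D.IsLocallyOptimal z m) : D.IsGloballyOptimal z m := by
  refine ⟨h.primal.isGlobalSolution, fun z' => ?_, h.dual, h.slack⟩
  have hf : D.IsFeasible z := h.primal.1
  rw [lagrangian_eq, lagrangian_eq]
  refine add_le_add (add_le_add le_rfl (Finset.sum_le_sum fun j _ => add_le_add ?_ le_rfl))
    (Finset.sum_le_sum fun i _ => add_le_add (add_le_add ?_ ?_) le_rfl)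
  · refine quadratic_min (D.α_pos j) ?_ _
    rw [h.stationary.gen j]
    abel
  · exact quadratic_min (D.β_pos i) (h.stationary.depth i) _
  · have hθ := h.stationary.depth i
    rw [hf.rainflow i, cycleDepths_eq] at hθ
    have hβ : 0 ≤ 1 / D.β i := by have := D.β_pos i; positivity
    -- The prices inherit the order and sign of the sorted depths, which is what makes `θ ⬝ᵥ N(v)v`
    -- convex.
    have hm : Monotone (m.θ i) := by
      rw [hθ]
      exact fun j k hjk => mul_le_mul_of_nonneg_left (sortedDepths_mono _ hjk) hβ
    have h0 : ∀ k, 0 ≤ m.θ i k := by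
      rw [hθ]
      exact fun k => mul_nonneg hβ (sortedDepths_nonneg _ k)
    obtain ⟨w, hw, hlam⟩ := h.stationary.rate i
    have e : m.lam - (fun _ => m.δ i) - (cumMatrix T (D.E i))ᵀ *ᵥ (m.μHi i - m.μLo i) - m.κHi i
        + m.κLo i = w := by
      rw [hlam]
      abel
    obtain ⟨h1, h2⟩ := convexHull_subgradient _ _ hm h0 hw
    rw [e, h2]
    have := h1 (z'.2.1 i)
    simp only [cycleDepths]
    linarith

/-! ### A nonconvex feasible set -/

/-- One storage unit of capacity `1`, half full, and one generator, without demand. -/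
def nonconvexExample : Data (Fin 1) (Fin 1) 2 where
  d := 0
  α _ := 1
  α_pos _ := one_pos
  β _ := 1
  β_pos _ := one_pos
  gLo _ := -1
  gHi _ := 1
  uLo _ := -1
  uHi _ := 1
  E _ := 1
  E_pos _ := one_pos
  x₀ _ := 1 / 2

/-- At threshold `0` the sum of the depths is the maximal variation over paths, at least the first
step `|x 0 - x 1|`. -/
theorem sum_sortedDepths_pos {T : ℕ} {x : Fin (T + 2) → ℝ} (h : x 1 ≠ x 0) :
    0 < ∑ k, sortedDepths x k := by
  have e : ∀ k, sortedDepths x k = trunc 0 (sortedDepths x k) := fun k => by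
    rw [trunc, sub_zero, max_eq_left (sortedDepths_nonneg x k)]
  rw [Finset.sum_congr rfl fun k _ => e k, sum_trunc_sortedDepths le_rfl, List.finRange_succ,
    List.map_cons, truncVar_cons]
  refine lt_of_lt_of_le ?_ (step_le_visit _ _ _ _)
  have h1 : 0 < |x 0 - x (Fin.succ 0)| := abs_pos.2 (sub_ne_zero.2 h.symm)
  have h2 : ∀ (l : List (Fin (T + 2))) y, 0 ≤ truncVar 0 x l y := by
    intro l
    induction l with
    | nil => exact fun _ => le_rfl
    | cons a l ih => exact fun y => (ih y).trans (le_visit _ _ _ _)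
  have h3 := sub_le_trunc 0 |x 0 - x (Fin.succ 0)|
  linarith [h2 (((List.finRange T).map Fin.succ).map Fin.succ) (x (Fin.succ 0))]

/-- The rates `(1/2, -1/2)` and `(-1/2, 1/2)` both have positive total depth, but their midpoint is
the zero rate, whose depths vanish; the averaged `ν` violates the Rainflow constraint. -/
theorem not_convex_nonconvexExample : ¬ Convex ℝ nonconvexExample.feasibleSet := by
  intro hc
  set D := nonconvexExample
  have hfeas : ∀ a : ℝ, |a| ≤ 1 / 2 →
      D.lift (fun _ => ![-a, a], fun _ => ![a, -a]) ∈ D.feasibleSet := by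
    intro a ha
    obtain ⟨h1, h2⟩ := abs_le.1 ha
    refine ⟨fun i => rfl, fun j k => ?_, fun i k => ?_, fun i => ?_, fun i k => ?_, ?_⟩
    · fin_cases k <;> simp [D, nonconvexExample, lift] <;> constructor <;> linarith
    · fin_cases k <;> simp [D, nonconvexExample, lift] <;> constructor <;> linarith
    · simp [lift]
    · fin_cases k <;>
        simp [D, nonconvexExample, lift, cumMatrix, Matrix.mulVec, dotProduct] <;>
        first | (constructor <;> linarith) | norm_num
    · funext k
      fin_cases k <;> simp [D, nonconvexExample, lift]
  have hpos : ∀ a : ℝ, a ≠ 0 → 0 < ∑ k, D.cycleDepths 0 ![a, -a] k := by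
    intro a ha
    rw [cycleDepths_eq]
    refine sum_sortedDepths_pos ?_
    simpa [soc, D, nonconvexExample, Finset.sum_filter, Fin.sum_univ_two] using ha
  have hmid := hc (hfeas (1 / 2) (by norm_num)) (hfeas (-(1 / 2)) (by norm_num))
    (show (0 : ℝ) ≤ 1 / 2 by norm_num) (show (0 : ℝ) ≤ 1 / 2 by norm_num) (by norm_num)
  have hr : ((1 / 2 : ℝ) • D.cycleDepths 0 ![1 / 2, -(1 / 2)]
      + (1 / 2 : ℝ) • D.cycleDepths 0 ![-(1 / 2), - -(1 / 2)])
      = D.cycleDepths 0 ((1 / 2 : ℝ) • ![1 / 2, -(1 / 2)] + (1 / 2 : ℝ) • ![-(1 / 2), - -(1 / 2)]) :=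
    hmid.rainflow 0
  have h0 : ((1 / 2 : ℝ) • ![1 / 2, -(1 / 2)] + (1 / 2 : ℝ) • ![-(1 / 2), - -(1 / 2)]
      : Fin 2 → ℝ) = 0 := by
    funext k
    fin_cases k <;> norm_num
  have hz : D.cycleDepths 0 0 = 0 := Matrix.mulVec_zero _
  rw [h0, hz] at hr
  have hs := congrArg (fun v : Fin 2 → ℝ => ∑ k, v k) hr
  simp only [Pi.add_apply, Pi.smul_apply, smul_eq_mul, Finset.sum_add_distrib, ← Finset.mul_sum,
    Pi.zero_apply, Finset.sum_const_zero] at hs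
  have h1 := hpos (1 / 2) (by norm_num)
  have h2 := hpos (-(1 / 2)) (by norm_num)
  linarith

end Data

end

end CycleAware

theorem mainTheorem2 :
    (∃ D : CycleAware.Data (Fin 1) (Fin 1) 2, ¬ Convex ℝ D.feasibleSet) ∧
    ∀ (G S : Type*) [Fintype G] [Fintype S] (T : ℕ) (D : CycleAware.Data G S T),
      (∀ z : CycleAware.Point G S T, D.IsLocalSolution z → D.IsGlobalSolution z) ∧
      (∀ (z : CycleAware.Point G S T) (m : CycleAware.Multipliers G S T),
        D.IsLocallyOptimal z m → D.IsGloballyOptimal z m) :=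
  ⟨⟨CycleAware.Data.nonconvexExample, CycleAware.Data.not_convex_nonconvexExample⟩,
    fun _ _ _ _ _ _ => ⟨fun _ h => h.isGlobalSolution, fun _ _ h => h.isGloballyOptimal⟩⟩
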